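/- Let $n\ge 0$, let $y_{\min},y_{\max},\delta_v\in\mathbb R^n$, $y_{avg}=\tfrac12(y_{\max}+y_{\min})$, $\delta_y=\tfrac12(y_{\max}-y_{\min})$, and let $Q$ be the set of pairs $(y,\dot y)\in\mathbb R^n\times\mathbb R^n$ with $y_{\min}<y<y_{\max}$ and $|\dot y|<\delta_v$ (componentwise). Functions $\tanh,\tanh^{-1}$ of vectors are componentwise and $\breve v$ denotes $\mathrm{diag}(v)$. Let $f:\mathbb R\to\mathbb R^n$ be $C^3$ and periodic with period $T>0$, with $q_d(t):=(f(t),f'(t))\in Q$ for all $t$, and $$\delta_{y,i}^2\,|f_i'(\varphi)|<\bigl|\delta_{y,i}^2-(f_i(\varphi)-y_{avg,i})^2\bigr|\,\delta_{v,i}\qquad(\varphi\in[0,T],\ 1\le i\le n).$$ Let $B,K,D$ be positive definite diagonal $n\times n$ matrices with $KB^{-1}D-B$ positive definite, and $\gamma\ge0$. Put $g_p=\tanh^{-1}(\breve\delta_y^{-1}(f-y_{avg}))$, $g_v=\tanh^{-1}(\breve\delta_v^{-1}f')$, $x^*=(g_p,g_v)$, $J_{s_1}=\breve\delta_y(I-\tanh^2\breve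 s_1)$, $J_{g_p}=\breve\delta_y(I-\tanh^2\breve g_p)$, $\psi(s_1,\varphi)=\tanh^{-1}(J_{s_1}J_{g_p}^{-1}\tanh g_v)$, $e_1=s_1-g_p(\varphi)$, $e_2=s_2-\psi$. The bounded output programmable oscillator with state $(x,\varphi)$, $x=(s_1,s_2)\in\mathbb R^{2n}$, is $$\begin{aligned}J_{s_1}\dot s_1&=\breve\delta_v\tanh s_2,\\ \dot s_2&=\psi_\varphi+\psi_t-Be_1-Ke_2-B^{-1}DJ_{s_1}^{-1}\breve\delta_v(\tanh s_2-\tanh\psi),\\ \dot\varphi&=1+\gamma\bigl((e_1^\top D+e_2^\top B)J_{g_p}^{-1}\breve\delta_v\tanh g_v+(e_1^\top B+e_2^\top K)\psi_\varphi\bigr),\\ y&=y_{avg}+\breve\delta_y\tanh s_1,\end{aligned}$$ where $\psi_\varphi=\partial\psi/\partial\varphi$ and $\psi_t=\frac{\partial\psi}{\partial s_1}\dot s_1$ is the time derivative of $\psi$ at frozen $\varphi$. Then, from every initial state, there is a unique solution for all $t\ge0$, and: 1. For every $\gamma\ge0$ and every solution, $x$ is bounded on $[0,\infty)$ and $x(t)-x^*(\varphi(t))\to0$.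 2. If $\gamma=0$, then for every $\varphi_0$ the curve $[x^*(t+\varphi_0),t+\varphi_0]$ is a solution, it is Lyapunov stable in $\mathbb R^{2n+1}$, and every solution with $\varphi(0)=\varphi_0$ converges to it. 3. $x^*$ is a globally stable limit cycle in the following sense. (a) For every $\gamma\ge0$, $[x^*(t),t]$ is a solution whose orbit in $\mathbb R^{2n+1}$ is orbitally stable and attracts every solution. (b) $x^*$ is $T$-periodic, and for every $\gamma\ge 0$ and every solution the distance from $x(t)$ to the curve $x^*(\mathbb R)$ tends to $0$. (c) (Limit $\gamma\to\infty$.) If $f$ is constant, or $f'$ and $f''$ have no common zero, there is $\rho>0$ such that for every $\varepsilon>0$ there is $\delta>0$ such that for all sufficiently large $\gamma$, every solution and every $t_0\ge0$: if $\|x(t_0)-x^*(\tau)\|<\delta$ for some $\tau$ with $|\tau-\varphi(t_0)|<\rho$, then $\operatorname{dist}(x(t),x^*(\mathbb R))<\varepsilon$ for all $t\ge t_0$. 4. For every $\gamma\ge0$ and every solution, $y$ is differentiable, $(y(t),\dot y(t))\in Q$ for all $t\ge0$, and the distance from $(y(t),\dot y(t))$ to the curve $q_d(\mathbb R)$ tends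 to $0$. -/

import Mathlib

open Filter Topology Set
open scoped Matrix

noncomputable section

namespace BoundedOscillator

/-! ### Stability notions for an autonomous system `z' = h z` -/

section Stability

variable {E : Type*} [NormedAddCommGroup E] [NormedSpace ℝ E]

/-- `z` solves `z' = h z` for all times `t ≥ 0`
(with the right derivative at `t = 0`). -/
def IsSolution (h : E → E) (z : ℝ → E) : Prop :=
  IsIntegralCurveOn z (fun _ => h) (Ici 0)

/-- Lyapunov stability of the trajectory `w`. -/
def StableTrajectory (h : E → E) (w : ℝ → E) : Prop :=
  ∀ ε > 0, ∀ t₀ ≥ 0, ∃ δ > 0, ∀ z : ℝ → E, IsSolution h z →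
    ‖z t₀ - w t₀‖ < δ → ∀ t ≥ t₀, ‖z t - w t‖ < ε

/-- Orbital stability: stability of the set `P` of points of a trajectory. -/
def OrbitallyStable (h : E → E) (P : Set E) : Prop :=
  ∀ ε > 0, ∀ t₀ ≥ 0, ∃ δ > 0, ∀ z : ℝ → E, IsSolution h z →
    Metric.infDist (z t₀) P < δ → ∀ t ≥ t₀, Metric.infDist (z t) P < ε

/-- Every solution converges to the set `P`. -/
def GloballyAttracting (h : E → E) (P : Set E) : Prop :=
  ∀ z : ℝ → E, IsSolution h z → Tendsto (fun t => Metric.infDist (z t) P) atTop (𝓝 0)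

end Stability

/-! ### The oscillator -/

/-- The shape space `ℝ²ⁿ`, and also the space of pairs `(y, y')`. -/
abbrev ShapeSpace (n : ℕ) := EuclideanSpace ℝ (Fin n ⊕ Fin n)

/-- The state space `ℝ²ⁿ⁺¹` of triples `(s₁, s₂, φ)`. -/
abbrev StateSpace (n : ℕ) := EuclideanSpace ℝ ((Fin n ⊕ Fin n) ⊕ Unit)

/-- The vector `[a; b]` of `ℝ²ⁿ`. -/
def mkShape {n : ℕ} (a b : Fin n → ℝ) : ShapeSpace n :=
  WithLp.toLp 2 (Sum.elim a b)

/-- The vector `[x; φ]` of `ℝ²ⁿ⁺¹`. -/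
def mkState {n : ℕ} (x : ShapeSpace n) (φ : ℝ) : StateSpace n :=
  WithLp.toLp 2 (Sum.elim (fun j => x j) (fun _ => φ))

/-- The component `s₁` of a state. -/
def s₁ {n : ℕ} (z : StateSpace n) : Fin n → ℝ := fun i => z (Sum.inl (Sum.inl i))

/-- The component `s₂` of a state. -/
def s₂ {n : ℕ} (z : StateSpace n) : Fin n → ℝ := fun i => z (Sum.inl (Sum.inr i))

/-- The phase `φ` of a state. -/
def phase {n : ℕ} (z : StateSpace n) : ℝ := z (Sum.inr ())

/-- The shape state `x = [s₁; s₂]` of a state. -/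
def shape {n : ℕ} (z : StateSpace n) : ShapeSpace n := mkShape (s₁ z) (s₂ z)

/-- Componentwise hyperbolic tangent. -/
def vtanh {n : ℕ} (v : Fin n → ℝ) : Fin n → ℝ := fun i => Real.tanh (v i)

/-- Componentwise inverse hyperbolic tangent. -/
def vartanh {n : ℕ} (v : Fin n → ℝ) : Fin n → ℝ := fun i => Real.artanh (v i)

/-- The diagonal matrix `diag(c) (I - tanh² (diag v))`. -/
def sechMatrix {n : ℕ} (c v : Fin n → ℝ) : Matrix (Fin n) (Fin n) ℝ :=
  Matrix.diagonal c * (1 - Matrix.diagonal (vtanh v) ^ 2)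

/-- The data of a bounded output programmable oscillator, except for the gain `γ`. -/
structure Data (n : ℕ) where
  /-- lower position limits -/
  yMin : Fin n → ℝ
  /-- upper position limits -/
  yMax : Fin n → ℝ
  /-- velocity limits -/
  δv : Fin n → ℝ
  /-- desired output -/
  f : ℝ → Fin n → ℝ
  B : Matrix (Fin n) (Fin n) ℝ
  K : Matrix (Fin n) (Fin n) ℝ
  D : Matrix (Fin n) (Fin n) ℝ

namespace Data

variable {n : ℕ} (p : Data n)

/-- Midpoint of the position limits. -/
def yAvg : Fin n → ℝ := fun i => (p.yMax i + p.yMin i) / 2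

/-- Half-width of the position limits. -/
def δy : Fin n → ℝ := fun i => (p.yMax i - p.yMin i) / 2

/-- The pairs (position, velocity) that strictly respect all limits. -/
def Q : Set (ShapeSpace n) :=
  {q | ∀ i : Fin n, p.yMin i < q (Sum.inl i) ∧ q (Sum.inl i) < p.yMax i ∧
    |q (Sum.inr i)| < p.δv i}

/-- The desired trajectory `q_d = [f; f']`. -/
def qd (t : ℝ) : ShapeSpace n := mkShape (p.f t) (deriv p.f t)

/-- `g_p = artanh (diag(δ_y)⁻¹ (f - y_avg))`. -/
def gp (φ : ℝ) : Fin n → ℝ :=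
  vartanh ((Matrix.diagonal p.δy)⁻¹ *ᵥ (p.f φ - p.yAvg))

/-- `g_v = artanh (diag(δ_v)⁻¹ f')`. -/
def gv (φ : ℝ) : Fin n → ℝ :=
  vartanh ((Matrix.diagonal p.δv)⁻¹ *ᵥ deriv p.f φ)

/-- The desired shape state `x* = [g_p; g_v]`. -/
def xStar (φ : ℝ) : ShapeSpace n := mkShape (p.gp φ) (p.gv φ)

/-- `J_{s₁}`. -/
def Js (a : Fin n → ℝ) : Matrix (Fin n) (Fin n) ℝ := sechMatrix p.δy a

/-- `J_{g_p}`. -/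
def Jgp (φ : ℝ) : Matrix (Fin n) (Fin n) ℝ := sechMatrix p.δy (p.gp φ)

/-- `ψ = artanh (J_{s₁} J_{g_p}⁻¹ tanh g_v)`, as a function of `s₁ = a` and `φ`. -/
def psi (a : Fin n → ℝ) (φ : ℝ) : Fin n → ℝ :=
  vartanh ((p.Js a * (p.Jgp φ)⁻¹) *ᵥ vtanh (p.gv φ))

/-- The velocity of `s₁`: the solution of `J_{s₁} s₁' = diag(δ_v) tanh s₂`. -/
def s₁Dot (a b : Fin n → ℝ) : Fin n → ℝ :=
  (p.Js a)⁻¹ *ᵥ (Matrix.diagonal p.δv *ᵥ vtanh b)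

/-- `ψ_φ`: the partial derivative of `ψ` with respect to the phase. -/
def psiPhase (a : Fin n → ℝ) (φ : ℝ) : Fin n → ℝ := deriv (fun θ => p.psi a θ) φ

/-- `ψ_t`: the time derivative of `ψ` at frozen phase, where `s₁` moves with velocity `s₁'`. -/
def psiTime (a b : Fin n → ℝ) (φ : ℝ) : Fin n → ℝ :=
  fderiv ℝ (fun c => p.psi c φ) a (p.s₁Dot a b)

/-- `e₁ = s₁ - g_p`. -/
def e₁ (a : Fin n → ℝ) (φ : ℝ) : Fin n → ℝ := a - p.gp φ

/-- `e₂ = s₂ - ψ`. -/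
def e₂ (a b : Fin n → ℝ) (φ : ℝ) : Fin n → ℝ := b - p.psi a φ

/-- The velocity of `s₂`. -/
def s₂Dot (a b : Fin n → ℝ) (φ : ℝ) : Fin n → ℝ :=
  p.psiPhase a φ + p.psiTime a b φ - p.B *ᵥ p.e₁ a φ - p.K *ᵥ p.e₂ a b φ
    - (p.B⁻¹ * p.D * (p.Js a)⁻¹ * Matrix.diagonal p.δv) *ᵥ (vtanh b - vtanh (p.psi a φ))

/-- The velocity of the phase, for the gain `γ`. -/
def phaseDot (γ : ℝ) (a b : Fin n → ℝ) (φ : ℝ) : ℝ :=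
  1 + γ * ((p.e₁ a φ ᵥ* p.D + p.e₂ a b φ ᵥ* p.B) ⬝ᵥ
        (((p.Jgp φ)⁻¹ * Matrix.diagonal p.δv) *ᵥ vtanh (p.gv φ))
      + (p.e₁ a φ ᵥ* p.B + p.e₂ a b φ ᵥ* p.K) ⬝ᵥ p.psiPhase a φ)

/-- The right-hand side of the bounded output programmable oscillator with gain `γ`. -/
def field (γ : ℝ) (z : StateSpace n) : StateSpace n :=
  mkState (mkShape (p.s₁Dot (s₁ z) (s₂ z)) (p.s₂Dot (s₁ z) (s₂ z) (phase z)))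
    (p.phaseDot γ (s₁ z) (s₂ z) (phase z))

/-- The output `y = y_avg + diag(δ_y) tanh s₁` along a curve of states. -/
def output (z : ℝ → StateSpace n) (t : ℝ) : Fin n → ℝ :=
  p.yAvg + Matrix.diagonal p.δy *ᵥ vtanh (s₁ (z t))

/-- The pair `[y; y']` of the output and its time derivative (one-sided at `t = 0`). -/
def outputPair (z : ℝ → StateSpace n) (t : ℝ) : ShapeSpace n :=
  mkShape (p.output z t) (derivWithin (p.output z) (Ici 0) t)

end Data

end BoundedOscillator

end

open BoundedOscillator

/-! All gains are diagonal, so the oscillator is a family of scalar pairs `(s₁ i, s₂ i)` that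
interact only through the phase. With `r = f' / (δv · sech² g_p)` the reference becomes `ψ = artanh
(sech² s₁ · r)`, and `g_p' = κ r`, where `κ = δv / δy`. The inequality assumed on `[0, T]` says
exactly that `|r| < 1`; periodicity and compactness improve this to `|r| ≤ ρ < 1`. `Model`
axiomatises these scalar facts and `field_eq` identifies the two vector fields.

The Lyapunov function is `V = ∑ (d e₁² / 2 + b e₁ e₂ + k e₂² / 2)`. Positivity of `K B⁻¹ D - B`
means `b² < k d`, so `V` is comparable with the squared distance from the shape to `x*(φ)`
(`exists_energy_equiv`). The phase law is the gradient law `φ' = 1 - γ ∂V/∂φ`; with `slope = -∂V/∂φ`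
this gives `V' = -γ slope² - dissipation` (`hasDerivWithinAt_energy`). The dissipation does not
involve `γ` and dominates a multiple of `V` on each sublevel set
(`exists_mul_energy_le_dissipation`). Hence `V` decays exponentially for every `γ ≥ 0`. This bounds
the shape, excludes blow-up, and gives convergence to `x*(φ)`. Stability of the orbit follows from
monotonicity of `V` with constants free of `γ`; for `γ = 0` the phase error is moreover constant.

For high gain a small shape error at a wrong phase must not push the shape away from the curve. The
second derivative of `V` in the phase at the desired state is a positive definite form in `(κ r,
ψ_φ)`, nonzero if `f'` and `f''` have no common zero. So near the right phase `slope` vanishes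
nowhere else, and `V` has a barrier at a fixed phase distance. The shape moves at a speed
independent of `γ`. While it has hardly moved, the barrier confines the phase and the term `γ
slope²` makes `V` small, and `V` stays small afterwards (`highGain_stable`).

The output pair is a Lipschitz function of the shape with values in `Q` that maps `x*` to `q_d`;
this transfers the convergence to the output. -/

noncomputable section

namespace BoundedOscillator

/-! ### Calculus of `tanh`, `artanh` and `ψ` -/

/-- The derivative `1 - tanh²` of `tanh`. -/
def sechSq (x : ℝ) : ℝ := 1 - Real.tanh x ^ 2

lemma sechSq_pos (x : ℝ) : 0 < sechSq x := by
  have := Real.tanh_sq_lt_one x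
  unfold sechSq; linarith

lemma sechSq_le_one (x : ℝ) : sechSq x ≤ 1 := by
  unfold sechSq; nlinarith [sq_nonneg (Real.tanh x)]

lemma hasDerivAt_tanh (x : ℝ) : HasDerivAt Real.tanh (sechSq x) x := by
  have h := (Real.hasDerivAt_sinh x).div (Real.hasDerivAt_cosh x) (Real.cosh_pos x).ne'
  have he : Real.tanh = fun y => Real.sinh y / Real.cosh y := by
    funext y; exact Real.tanh_eq_sinh_div_cosh y
  rw [he]
  refine HasDerivAt.congr_deriv h ?_
  have := (Real.cosh_pos x).ne'
  simp only [sechSq, Real.tanh_eq_sinh_div_cosh]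
  field_simp

lemma contDiff_tanh {m : WithTop ℕ∞} : ContDiff ℝ m Real.tanh := by
  have he : Real.tanh = fun y => Real.sinh y / Real.cosh y := by
    funext y; exact Real.tanh_eq_sinh_div_cosh y
  rw [he]
  exact Real.contDiff_sinh.div Real.contDiff_cosh fun x => (Real.cosh_pos x).ne'

lemma contDiff_sechSq {m : WithTop ℕ∞} : ContDiff ℝ m sechSq :=
  contDiff_const.sub (contDiff_tanh.pow 2)

lemma hasDerivAt_sechSq (x : ℝ) :
    HasDerivAt sechSq (-2 * Real.tanh x * sechSq x) x := by
  have h := ((hasDerivAt_tanh x).pow 2).const_sub 1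
  refine h.congr_deriv ?_
  norm_num

lemma artanh_eventuallyEq {x : ℝ} (hx : |x| < 1) :
    Real.artanh =ᶠ[𝓝 x] fun y => 1 / 2 * Real.log ((1 + y) / (1 - y)) := by
  filter_upwards [Ioo_mem_nhds (abs_lt.1 hx).1 (abs_lt.1 hx).2] with y hy
  exact Real.artanh_eq_half_log (Ioo_subset_Icc_self hy)

lemma hasDerivAt_artanh {x : ℝ} (hx : |x| < 1) :
    HasDerivAt Real.artanh (1 / (1 - x ^ 2)) x := by
  obtain ⟨h1, h2⟩ := abs_lt.1 hx
  have hp : 0 < 1 + x := by linarith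
  have hm : 0 < 1 - x := by linarith
  have hd : HasDerivAt (fun y : ℝ => (1 + y) / (1 - y))
      ((1 * (1 - x) - (1 + x) * (-1)) / (1 - x) ^ 2) x :=
    ((hasDerivAt_id x).const_add 1).div ((hasDerivAt_id x).const_sub 1) hm.ne'
  have h := (hd.log (div_pos hp hm).ne').const_mul (1 / 2 : ℝ)
  refine (h.congr_of_eventuallyEq (artanh_eventuallyEq hx)).congr_deriv ?_
  have : 1 - x ^ 2 ≠ 0 := by nlinarith
  field_simp
  ring

lemma contDiffAt_artanh {m : WithTop ℕ∞} {x : ℝ} (hx : |x| < 1) :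
    ContDiffAt ℝ m Real.artanh x := by
  obtain ⟨h1, h2⟩ := abs_lt.1 hx
  have hp : 0 < 1 + x := by linarith
  have hm : 0 < 1 - x := by linarith
  refine ContDiffAt.congr_of_eventuallyEq ?_ (artanh_eventuallyEq hx)
  exact contDiffAt_const.mul (((contDiffAt_const.add contDiffAt_id).div
    (contDiffAt_const.sub contDiffAt_id) hm.ne').log (div_pos hp hm).ne')

lemma abs_tanh_sub_tanh_le (x y : ℝ) : |Real.tanh x - Real.tanh y| ≤ |x - y| := by
  have := Convex.norm_image_sub_le_of_norm_hasDerivWithin_le (f := Real.tanh) (C := 1)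
    (s := univ) (fun x _ => (hasDerivAt_tanh x).hasDerivWithinAt)
    (fun x _ => by
      rw [Real.norm_eq_abs, abs_of_pos (sechSq_pos x)]; exact sechSq_le_one x)
    convex_univ (mem_univ y) (mem_univ x)
  simpa using this

lemma sechSq_le_of_abs_le {x S : ℝ} (h : |x| ≤ S) : sechSq S ≤ sechSq x := by
  have hmono : Monotone Real.tanh :=
    monotone_of_deriv_nonneg (fun x => (hasDerivAt_tanh x).differentiableAt)
      fun x => by rw [(hasDerivAt_tanh x).deriv]; exact (sechSq_pos x).le
  have h1 := hmono (abs_le.1 h).1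
  have h2 := hmono (abs_le.1 h).2
  rw [Real.tanh_neg] at h1
  unfold sechSq
  nlinarith

/-- `tanh` is strongly monotone on bounded sets. -/
lemma sechSq_mul_sq_le {x y S : ℝ} (hx : |x| ≤ S) (hy : |y| ≤ S) :
    sechSq S * (x - y) ^ 2 ≤ (x - y) * (Real.tanh x - Real.tanh y) := by
  have hd : ∀ t, HasDerivAt (fun t => Real.tanh t - sechSq S * t) (sechSq t - sechSq S) t :=
    fun t => ((hasDerivAt_tanh t).sub ((hasDerivAt_id t).const_mul _)).congr_deriv (by simp)
  have hmono : MonotoneOn (fun t => Real.tanh t - sechSq S * t) (Icc (-S) S) := by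
    refine monotoneOn_of_deriv_nonneg (convex_Icc _ _)
      (fun t _ => (hd t).continuousAt.continuousWithinAt)
      (fun t _ => (hd t).differentiableAt.differentiableWithinAt) fun t ht => ?_
    rw [(hd t).deriv, sub_nonneg]
    exact sechSq_le_of_abs_le (abs_le.2 (mem_Icc.1 (interior_subset ht)))
  rcases le_total x y with h | h
  · have := hmono (abs_le.1 hx) (abs_le.1 hy) h
    simp only at this
    nlinarith
  · have := hmono (abs_le.1 hy) (abs_le.1 hx) h
    simp only at this
    nlinarith

/-- The scalar function `ψ`: `artanh (sech² s · r)`. -/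
def scalarPsi (s r : ℝ) : ℝ := Real.artanh (sechSq s * r)

/-- The partial derivative of `scalarPsi` in `s`. -/
def scalarPsiS (s r : ℝ) : ℝ :=
  -2 * Real.tanh s * sechSq s * r / (1 - (sechSq s * r) ^ 2)

/-- The partial derivative of `scalarPsi` in `r`. -/
def scalarPsiR (s r : ℝ) : ℝ := sechSq s / (1 - (sechSq s * r) ^ 2)

lemma abs_sechSq_mul_le (s r : ℝ) : |sechSq s * r| ≤ |r| := by
  rw [abs_mul, abs_of_pos (sechSq_pos s)]
  exact mul_le_of_le_one_left (abs_nonneg r) (sechSq_le_one s)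

lemma abs_sechSq_mul_lt_one {s r : ℝ} (hr : |r| < 1) : |sechSq s * r| < 1 :=
  (abs_sechSq_mul_le s r).trans_lt hr

lemma one_sub_sechSq_mul_sq_pos {s r : ℝ} (hr : |r| < 1) : 0 < 1 - (sechSq s * r) ^ 2 := by
  have := (sq_lt_one_iff_abs_lt_one (sechSq s * r)).2 (abs_sechSq_mul_lt_one hr)
  linarith

lemma tanh_scalarPsi {s r : ℝ} (hr : |r| < 1) :
    Real.tanh (scalarPsi s r) = sechSq s * r :=
  Real.tanh_artanh (abs_lt.1 (abs_sechSq_mul_lt_one hr))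

lemma scalarPsiR_pos {s r : ℝ} (hr : |r| < 1) : 0 < scalarPsiR s r :=
  div_pos (sechSq_pos s) (one_sub_sechSq_mul_sq_pos hr)

lemma hasFDerivAt_scalarPsi {E : Type*} [NormedAddCommGroup E] [NormedSpace ℝ E]
    {u w : E → ℝ} {u' w' : E →L[ℝ] ℝ} {S : Set E} {x : E} (hu : HasFDerivWithinAt u u' S x)
    (hw : HasFDerivWithinAt w w' S x) (hr : |w x| < 1) :
    HasFDerivWithinAt (fun y => scalarPsi (u y) (w y))
      (scalarPsiS (u x) (w x) • u' + scalarPsiR (u x) (w x) • w') S x := by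
  have h1 := ((hasDerivAt_sechSq (u x)).comp_hasFDerivWithinAt x hu).mul hw
  have h2 := (hasDerivAt_artanh (abs_sechSq_mul_lt_one (s := u x) hr)).comp_hasFDerivWithinAt x h1
  refine h2.congr_fderiv ?_
  ext v
  simp [scalarPsiS, scalarPsiR]
  ring

lemma hasDerivWithinAt_scalarPsi {u w : ℝ → ℝ} {u' w' : ℝ} {S : Set ℝ} {x : ℝ}
    (hu : HasDerivWithinAt u u' S x) (hw : HasDerivWithinAt w w' S x) (hr : |w x| < 1) :
    HasDerivWithinAt (fun y => scalarPsi (u y) (w y))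
      (scalarPsiS (u x) (w x) * u' + scalarPsiR (u x) (w x) * w') S x := by
  have h := (hasFDerivAt_scalarPsi hu.hasFDerivWithinAt hw.hasFDerivWithinAt hr).hasDerivWithinAt
  refine h.congr_deriv ?_
  simp

lemma contDiff_scalarPsi {E : Type*} [NormedAddCommGroup E] [NormedSpace ℝ E]
    {m : WithTop ℕ∞} {u w : E → ℝ} (hu : ContDiff ℝ m u) (hw : ContDiff ℝ m w)
    (hr : ∀ x, |w x| < 1) : ContDiff ℝ m fun x => scalarPsi (u x) (w x) :=
  contDiff_iff_contDiffAt.2 fun x =>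
    (contDiffAt_artanh (abs_sechSq_mul_lt_one (hr x))).comp x
      ((contDiff_sechSq.comp hu).mul hw).contDiffAt

lemma contDiff_scalarPsiS {E : Type*} [NormedAddCommGroup E] [NormedSpace ℝ E]
    {m : WithTop ℕ∞} {u w : E → ℝ} (hu : ContDiff ℝ m u) (hw : ContDiff ℝ m w)
    (hr : ∀ x, |w x| < 1) : ContDiff ℝ m fun x => scalarPsiS (u x) (w x) :=
  (((contDiff_const.mul (contDiff_tanh.comp hu)).mul (contDiff_sechSq.comp hu)).mul hw).div
    (contDiff_const.sub (((contDiff_sechSq.comp hu).mul hw).pow 2))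
    fun x => (one_sub_sechSq_mul_sq_pos (hr x)).ne'

lemma contDiff_scalarPsiR {E : Type*} [NormedAddCommGroup E] [NormedSpace ℝ E]
    {m : WithTop ℕ∞} {u w : E → ℝ} (hu : ContDiff ℝ m u) (hw : ContDiff ℝ m w)
    (hr : ∀ x, |w x| < 1) : ContDiff ℝ m fun x => scalarPsiR (u x) (w x) :=
  (contDiff_sechSq.comp hu).div
    (contDiff_const.sub (((contDiff_sechSq.comp hu).mul hw).pow 2))
    fun x => (one_sub_sechSq_mul_sq_pos (hr x)).ne'

/-- Since `sech² ≤ 1`, the bound is uniform in `s`: the reference for `s₂` stays bounded however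
large `s₁` is. -/
lemma abs_scalarPsi_le {s r ρ : ℝ} (hρ : ρ < 1) (hr : |r| ≤ ρ) :
    |scalarPsi s r| ≤ Real.artanh ρ := by
  have h := (abs_sechSq_mul_le s r).trans hr
  obtain ⟨h1, h2⟩ := abs_le.1 h
  have hodd : Real.artanh (-ρ) = -Real.artanh ρ := by
    have h0 : 0 ≤ ρ := (abs_nonneg r).trans hr
    rw [← Real.artanh_tanh (-Real.artanh ρ), Real.tanh_neg,
      Real.tanh_artanh ⟨by linarith, hρ⟩]
  rw [abs_le, ← hodd]
  have h0 : 0 ≤ ρ := (abs_nonneg r).trans hr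
  exact ⟨Real.artanh_le_artanh (by linarith) (by linarith) h1,
    Real.artanh_le_artanh (by linarith) hρ h2⟩

/-- The `s`-derivative is `-2 tanh s · q / (1 - q²)` with `q = sech² s · r` and `|q| ≤ ρ`. The
Lipschitz constant makes `e₂` comparable with the deviation of `s₂` from its desired value. -/
lemma abs_scalarPsi_sub_le {s s' r ρ : ℝ} (hρ : ρ < 1) (hr : |r| ≤ ρ) :
    |scalarPsi s r - scalarPsi s' r| ≤ 2 / (1 - ρ ^ 2) * |s - s'| := by
  have h0 : 0 ≤ ρ := (abs_nonneg r).trans hr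
  have hr1 : |r| < 1 := hr.trans_lt hρ
  have hρ2 : 0 < 1 - ρ ^ 2 := by nlinarith
  have := Convex.norm_image_sub_le_of_norm_hasDerivWithin_le (f := fun s => scalarPsi s r)
    (C := 2 / (1 - ρ ^ 2)) (s := univ) (f' := fun s => scalarPsiS s r)
    (fun x _ => (hasDerivWithinAt_scalarPsi (hasDerivWithinAt_id x univ)
      (hasDerivWithinAt_const x univ r) hr1).congr_deriv (by simp))
    (fun x _ => by
      have h1 := one_sub_sechSq_mul_sq_pos (s := x) hr1
      rw [Real.norm_eq_abs, scalarPsiS, abs_div, abs_of_pos h1]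
      refine div_le_div₀ zero_le_two ?_ hρ2 ?_
      · have h3 := Real.abs_tanh_lt_one x
        have h4 := abs_sechSq_mul_lt_one (s := x) hr1
        rw [show -2 * Real.tanh x * sechSq x * r = -2 * (Real.tanh x * (sechSq x * r)) by ring,
          abs_mul, abs_mul (Real.tanh x)]
        have h5 := mul_le_one₀ h3.le (abs_nonneg _) h4.le
        norm_num at h5 ⊢
        exact h5
      · have h5 := pow_le_pow_left₀ (abs_nonneg _) ((abs_sechSq_mul_le x r).trans hr) 2
        rw [sq_abs] at h5
        linarith)
    convex_univ (mem_univ s') (mem_univ s)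
  simpa using this

/-! ### Global solutions of ordinary differential equations -/

section GlobalExistence

variable {E : Type*} [NormedAddCommGroup E] [NormedSpace ℝ E] [FiniteDimensional ℝ E]
  {h : E → E}

/-- Multiplying by a smooth bump function gives a compactly supported `C¹` field, which is globally
bounded and Lipschitz. -/
lemma exists_lipschitz_cutoff (hh : ContDiff ℝ 1 h) (R : ℝ) :
    ∃ (c : E → ℝ) (K L : NNReal), (∀ x, c x ∈ Icc (0 : ℝ) 1) ∧
      (∀ x ∈ Metric.closedBall (0 : E) R, c x = 1) ∧
      LipschitzWith K (fun x => c x • h x) ∧ ∀ x, ‖c x • h x‖ ≤ L := by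
  let b : ContDiffBump (0 : E) :=
    ⟨|R| + 1, |R| + 2, by positivity, by linarith⟩
  have hb : ContDiff ℝ 1 fun x => b x • h x := b.contDiff.smul hh
  have hs : HasCompactSupport fun x => b x • h x := b.hasCompactSupport.smul_right
  obtain ⟨K, hK⟩ := ContDiff.lipschitzWith_of_hasCompactSupport hs hb one_ne_zero
  obtain ⟨L, hL⟩ := hs.exists_bound_of_continuous hb.continuous
  refine ⟨b, K, ⟨max L 0, le_max_right _ _⟩, fun x => ⟨b.nonneg, b.le_one⟩, fun x hx => ?_, hK,
    fun x => (hL x).trans (le_max_left _ _)⟩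
  refine b.one_of_mem_closedBall (Metric.closedBall_subset_closedBall ?_ hx)
  change R ≤ |R| + 1
  linarith [le_abs_self R]

/-- Both curves stay in one ball on the compact interval. There `h` agrees with its cutoff and is
Lipschitz, so Grönwall uniqueness applies. -/
lemma eqOn_of_hasDerivWithinAt (hh : ContDiff ℝ 1 h) {N : ℝ} {z w : ℝ → E}
    (hz : ∀ t ∈ Icc 0 N, HasDerivWithinAt z (h (z t)) (Icc 0 N) t)
    (hw : ∀ t ∈ Icc 0 N, HasDerivWithinAt w (h (w t)) (Icc 0 N) t)
    (h0 : z 0 = w 0) : EqOn z w (Icc 0 N) := by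
  have hzc : ContinuousOn z (Icc 0 N) := fun t ht => (hz t ht).continuousWithinAt
  have hwc : ContinuousOn w (Icc 0 N) := fun t ht => (hw t ht).continuousWithinAt
  obtain ⟨R₁, hR₁⟩ := isCompact_Icc.exists_bound_of_continuousOn hzc
  obtain ⟨R₂, hR₂⟩ := isCompact_Icc.exists_bound_of_continuousOn hwc
  obtain ⟨c, K, L, hc, hc1, hK, -⟩ := exists_lipschitz_cutoff hh (max R₁ R₂)
  have hlip : LipschitzOnWith K h (Metric.closedBall 0 (max R₁ R₂)) := by
    intro x hx y hy
    simpa [hc1 x hx, hc1 y hy] using hK x y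
  have hnhds : ∀ t ∈ Ico 0 N, Icc 0 N ∈ 𝓝[Ici t] t := fun t ht =>
    mem_of_superset (Icc_mem_nhdsGE ht.2) (Icc_subset_Icc_left ht.1)
  refine ODE_solution_unique_of_mem_Icc_right (v := fun _ => h)
    (s := fun _ => Metric.closedBall 0 (max R₁ R₂)) (fun t _ => hlip) hzc
    (fun t ht => (hz t (Ico_subset_Icc_self ht)).mono_of_mem_nhdsWithin (hnhds t ht))
    (fun t ht => ?_) hwc
    (fun t ht => (hw t (Ico_subset_Icc_self ht)).mono_of_mem_nhdsWithin (hnhds t ht))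
    (fun t ht => ?_) h0
  · exact mem_closedBall_zero_iff.2 ((hR₁ t (Ico_subset_Icc_self ht)).trans (le_max_left _ _))
  · exact mem_closedBall_zero_iff.2 ((hR₂ t (Ico_subset_Icc_self ht)).trans (le_max_right _ _))

lemma IsSolution.eqOn (hh : ContDiff ℝ 1 h) {z w : ℝ → E} (hz : IsSolution h z)
    (hw : IsSolution h w) (h0 : z 0 = w 0) : EqOn z w (Ici 0) := fun t ht =>
  eqOn_of_hasDerivWithinAt hh (N := t)
    (fun s hs => (hz s hs.1).mono Icc_subset_Ici_self)
    (fun s hs => (hw s hs.1).mono Icc_subset_Ici_self) h0 (right_mem_Icc.2 ht)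

/-- A `C¹` vector field has global forward solutions if the solutions of all slowed down fields
`c • h` with `0 ≤ c ≤ 1` stay bounded on bounded time intervals. -/
theorem exists_isSolution_of_bounded (hh : ContDiff ℝ 1 h) (z₀ : E)
    (H : ∀ N : ℝ, ∃ R : ℝ, ∀ (c : E → ℝ) (z : ℝ → E), (∀ x, c x ∈ Icc (0 : ℝ) 1) → z 0 = z₀ →
      (∀ t ∈ Icc 0 N, HasDerivWithinAt z (c (z t) • h (z t)) (Icc 0 N) t) →
      ∀ t ∈ Icc 0 N, ‖z t‖ ≤ R) :
    ∃ z : ℝ → E, z 0 = z₀ ∧ IsSolution h z := by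
  have : CompleteSpace E := FiniteDimensional.complete ℝ E
  have hloc : ∀ N : ℕ, ∃ z : ℝ → E, z 0 = z₀ ∧
      ∀ t ∈ Icc (0 : ℝ) N, HasDerivWithinAt z (h (z t)) (Icc (0 : ℝ) N) t := by
    intro N
    obtain ⟨R, hR⟩ := H N
    obtain ⟨c, K, L, hc, hc1, hK, hL⟩ := exists_lipschitz_cutoff hh R
    -- The cut-off field is bounded by `L` everywhere, so the ball of radius `L * N` cannot be left
    -- before time `N` and one application covers the whole interval. The a priori bound `R`, chosen
    -- before the cutoff, then shows that the cutoff equals one along the solution.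
    have hpl : IsPicardLindelof (fun _ x => c x • h x)
        (⟨0, left_mem_Icc.2 N.cast_nonneg⟩ : Icc (0 : ℝ) N) z₀ (L * N) 0 L K :=
      IsPicardLindelof.of_time_independent (fun x _ => hL x) (hK.lipschitzOnWith)
        (by simp)
    obtain ⟨z, hz0, hz⟩ := hpl.exists_eq_forall_mem_Icc_hasDerivWithinAt₀
    refine ⟨z, hz0, fun t ht => ?_⟩
    have h1 := hc1 (z t) (mem_closedBall_zero_iff.2 (hR c z hc hz0 hz t ht))
    simpa [h1] using hz t ht
  choose u hu0 hu using hloc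
  have hmono : ∀ {M N : ℕ}, M ≤ N → EqOn (u M) (u N) (Icc (0 : ℝ) M) := fun {M N} hMN =>
    eqOn_of_hasDerivWithinAt hh (hu M)
      (fun t ht => (hu N t ⟨ht.1, ht.2.trans (Nat.cast_le.2 hMN)⟩).mono
        (Icc_subset_Icc_right (Nat.cast_le.2 hMN))) ((hu0 M).trans (hu0 N).symm)
  -- The pieces are glued by using at time `t` the solution on `[0, ⌊t⌋₊ + 1]`: the `+ 1` puts `t`
  -- strictly below the right end, so the derivative within the interval is one within `Ici 0`.
  have heq : ∀ N : ℕ, EqOn (fun t => u (⌊t⌋₊ + 1) t) (u N) (Ico (0 : ℝ) N) := by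
    intro N t ht
    refine hmono ((Nat.floor_lt ht.1).2 ht.2) ⟨ht.1, ?_⟩
    push_cast
    exact (Nat.lt_floor_add_one t).le
  refine ⟨fun t => u (⌊t⌋₊ + 1) t, hu0 _, fun t ht => ?_⟩
  have htN : t < ((⌊t⌋₊ + 1 : ℕ) : ℝ) := by push_cast; exact Nat.lt_floor_add_one t
  have hmem : Icc (0 : ℝ) ((⌊t⌋₊ + 1 : ℕ) : ℝ) ∈ 𝓝[Ici 0] t := by
    rw [← Ici_inter_Iic]
    exact inter_mem self_mem_nhdsWithin (mem_nhdsWithin_of_mem_nhds (Iic_mem_nhds htN))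
  refine ((hu (⌊t⌋₊ + 1) t ⟨ht, htN.le⟩).mono_of_mem_nhdsWithin hmem).congr_of_eventuallyEq
    ?_ rfl
  have hlt : Ico (0 : ℝ) ((⌊t⌋₊ + 1 : ℕ) : ℝ) ∈ 𝓝[Ici 0] t := by
    rw [← Ici_inter_Iio]
    exact inter_mem self_mem_nhdsWithin (mem_nhdsWithin_of_mem_nhds (Iio_mem_nhds htN))
  filter_upwards [hlt] with s hs using heq _ hs

end GlobalExistence

/-! ### Coordinates of states, the scalar model and its energy identity -/

@[simp] lemma mkShape_inl {n : ℕ} (a b : Fin n → ℝ) (i : Fin n) :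
    mkShape a b (Sum.inl i) = a i := rfl

@[simp] lemma mkShape_inr {n : ℕ} (a b : Fin n → ℝ) (i : Fin n) :
    mkShape a b (Sum.inr i) = b i := rfl

@[simp] lemma phase_mkState {n : ℕ} (x : ShapeSpace n) (φ : ℝ) : phase (mkState x φ) = φ := rfl

@[simp] lemma shape_mkState {n : ℕ} (x : ShapeSpace n) (φ : ℝ) : shape (mkState x φ) = x := by
  ext j; cases j <;> rfl

@[simp] lemma mkState_shape {n : ℕ} (z : StateSpace n) : mkState (shape z) (phase z) = z := by
  ext j
  rcases j with (j | j) | j <;> rfl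

/-- The bounded output programmable oscillator with diagonal gains, written in terms of the
scalar functions `g = g_p` and `r`, where `ψ = artanh (sech² s₁ · r)` and `g' = κ r`. -/
structure Model (n : ℕ) where
  /-- the ratio of the velocity limit to the half-width of the position limits -/
  κ : Fin n → ℝ
  b : Fin n → ℝ
  k : Fin n → ℝ
  d : Fin n → ℝ
  g : Fin n → ℝ → ℝ
  r : Fin n → ℝ → ℝ
  /-- the period -/
  T : ℝ
  T_pos : 0 < T
  κ_pos : ∀ i, 0 < κ i
  b_pos : ∀ i, 0 < b i
  k_pos : ∀ i, 0 < k i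
  d_pos : ∀ i, 0 < d i
  b_sq_lt : ∀ i, b i ^ 2 < k i * d i
  g_periodic : ∀ i, Function.Periodic (g i) T
  r_periodic : ∀ i, Function.Periodic (r i) T
  abs_r_lt_one : ∀ i φ, |r i φ| < 1
  contDiff_r : ∀ i, ContDiff ℝ 2 (r i)
  hasDerivAt_g : ∀ i φ, HasDerivAt (g i) (κ i * r i φ) φ

namespace Model

variable {n : ℕ} (m : Model n)

/-- The error `e₁`. -/
def err₁ (z : StateSpace n) (i : Fin n) : ℝ := s₁ z i - m.g i (phase z)

/-- The reference `ψ` of `s₂`. -/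
def psi (z : StateSpace n) (i : Fin n) : ℝ := scalarPsi (s₁ z i) (m.r i (phase z))

/-- The error `e₂`. -/
def err₂ (z : StateSpace n) (i : Fin n) : ℝ := s₂ z i - m.psi z i

/-- The derivative of `ψ` in the phase. -/
def psiPhase (z : StateSpace n) (i : Fin n) : ℝ :=
  scalarPsiR (s₁ z i) (m.r i (phase z)) * deriv (m.r i) (phase z)

/-- The velocity of `s₁`. -/
def vel₁ (z : StateSpace n) (i : Fin n) : ℝ := m.κ i * Real.tanh (s₂ z i) / sechSq (s₁ z i)

/-- The difference of the velocity of `s₁` and its reference. -/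
def gap (z : StateSpace n) (i : Fin n) : ℝ :=
  m.κ i * (Real.tanh (s₂ z i) - Real.tanh (m.psi z i)) / sechSq (s₁ z i)

/-- The velocity of `s₂`. -/
def vel₂ (z : StateSpace n) (i : Fin n) : ℝ :=
  m.psiPhase z i + scalarPsiS (s₁ z i) (m.r i (phase z)) * m.vel₁ z i
    - m.b i * m.err₁ z i - m.k i * m.err₂ z i - m.d i / m.b i * m.gap z i

/-- Minus the derivative of the energy in the phase. -/
def slope (z : StateSpace n) : ℝ :=
  ∑ i, ((m.d i * m.err₁ z i + m.b i * m.err₂ z i) * (m.κ i * m.r i (phase z))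
    + (m.b i * m.err₁ z i + m.k i * m.err₂ z i) * m.psiPhase z i)

/-- The vector field. -/
def field (γ : ℝ) (z : StateSpace n) : StateSpace n :=
  mkState (mkShape (m.vel₁ z) (m.vel₂ z)) (1 + γ * m.slope z)

/-- The Lyapunov function. -/
def energy (z : StateSpace n) : ℝ :=
  ∑ i, (m.d i * m.err₁ z i ^ 2 / 2 + m.b i * m.err₁ z i * m.err₂ z i
    + m.k i * m.err₂ z i ^ 2 / 2)

/-- The rate of decay of the energy that does not come from the phase. -/
def dissipation (z : StateSpace n) : ℝ :=
  ∑ i, ((m.b i * m.err₁ z i + m.k i * m.err₂ z i) ^ 2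
    + (m.k i * m.d i / m.b i - m.b i) * (m.err₂ z i * m.gap z i))

/-- The desired shape as a function of the phase. -/
def limitShape (φ : ℝ) : ShapeSpace n :=
  mkShape (fun i => m.g i φ) (fun i => scalarPsi (m.g i φ) (m.r i φ))

lemma gap_eq (z : StateSpace n) (i : Fin n) :
    m.gap z i = m.vel₁ z i - m.κ i * m.r i (phase z) := by
  have := (sechSq_pos (s₁ z i)).ne'
  rw [gap, psi, tanh_scalarPsi (m.abs_r_lt_one i _), vel₁]
  field_simp

lemma hasDerivAt_r (i : Fin n) (φ : ℝ) : HasDerivAt (m.r i) (deriv (m.r i) φ) φ :=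
  ((m.contDiff_r i).differentiable two_ne_zero φ).hasDerivAt

lemma contDiff_deriv_r (i : Fin n) : ContDiff ℝ 1 (deriv (m.r i)) :=
  ((contDiff_succ_iff_deriv (n := 1)).1 (by simpa [one_add_one_eq_two] using m.contDiff_r i)).2.2

lemma contDiff_g (i : Fin n) : ContDiff ℝ 2 (m.g i) := by
  have h : ContDiff ℝ (1 + 1) (m.g i) := by
    refine contDiff_succ_iff_deriv.2
      ⟨fun φ => (m.hasDerivAt_g i φ).differentiableAt, by simp, ?_⟩
    have : deriv (m.g i) = fun φ => m.κ i * m.r i φ := by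
      funext φ; exact (m.hasDerivAt_g i φ).deriv
    rw [this]
    exact contDiff_const.mul ((m.contDiff_r i).of_le one_le_two)
  simpa [one_add_one_eq_two] using h

/-! #### Smoothness -/

lemma contDiff_phase : ContDiff ℝ 1 (phase : StateSpace n → ℝ) :=
  contDiff_euclidean.1 contDiff_id _

lemma contDiff_s₁ (i : Fin n) : ContDiff ℝ 1 fun z : StateSpace n => s₁ z i :=
  contDiff_euclidean.1 contDiff_id (Sum.inl (Sum.inl i))

lemma contDiff_s₂ (i : Fin n) : ContDiff ℝ 1 fun z : StateSpace n => s₂ z i :=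
  contDiff_euclidean.1 contDiff_id (Sum.inl (Sum.inr i))

lemma contDiff_r_phase (i : Fin n) : ContDiff ℝ 1 fun z : StateSpace n => m.r i (phase z) :=
  ((m.contDiff_r i).of_le one_le_two).comp contDiff_phase

lemma contDiff_err₁ (i : Fin n) : ContDiff ℝ 1 fun z => m.err₁ z i :=
  (contDiff_s₁ i).sub (((m.contDiff_g i).of_le one_le_two).comp contDiff_phase)

lemma contDiff_psi (i : Fin n) : ContDiff ℝ 1 fun z => m.psi z i :=
  contDiff_scalarPsi (contDiff_s₁ i) (m.contDiff_r_phase i) fun _ => m.abs_r_lt_one i _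

lemma contDiff_err₂ (i : Fin n) : ContDiff ℝ 1 fun z => m.err₂ z i :=
  (contDiff_s₂ i).sub (m.contDiff_psi i)

lemma contDiff_psiPhase (i : Fin n) : ContDiff ℝ 1 fun z => m.psiPhase z i :=
  (contDiff_scalarPsiR (contDiff_s₁ i) (m.contDiff_r_phase i) fun _ => m.abs_r_lt_one i _).mul
    ((m.contDiff_deriv_r i).comp contDiff_phase)

lemma contDiff_vel₁ (i : Fin n) : ContDiff ℝ 1 fun z => m.vel₁ z i :=
  (contDiff_const.mul (contDiff_tanh.comp (contDiff_s₂ i))).div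
    (contDiff_sechSq.comp (contDiff_s₁ i)) fun _ => (sechSq_pos _).ne'

lemma contDiff_gap (i : Fin n) : ContDiff ℝ 1 fun z => m.gap z i :=
  (contDiff_const.mul ((contDiff_tanh.comp (contDiff_s₂ i)).sub
    (contDiff_tanh.comp (m.contDiff_psi i)))).div
    (contDiff_sechSq.comp (contDiff_s₁ i)) fun _ => (sechSq_pos _).ne'

lemma contDiff_vel₂ (i : Fin n) : ContDiff ℝ 1 fun z => m.vel₂ z i :=
  ((((m.contDiff_psiPhase i).add ((contDiff_scalarPsiS (contDiff_s₁ i) (m.contDiff_r_phase i)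
    fun _ => m.abs_r_lt_one i _).mul (m.contDiff_vel₁ i))).sub
    (contDiff_const.mul (m.contDiff_err₁ i))).sub (contDiff_const.mul (m.contDiff_err₂ i))).sub
    (contDiff_const.mul (m.contDiff_gap i))

lemma contDiff_slope : ContDiff ℝ 1 m.slope :=
  ContDiff.sum fun i _ =>
    (((contDiff_const.mul (m.contDiff_err₁ i)).add (contDiff_const.mul (m.contDiff_err₂ i))).mul
      (contDiff_const.mul (m.contDiff_r_phase i))).add
    (((contDiff_const.mul (m.contDiff_err₁ i)).add (contDiff_const.mul (m.contDiff_err₂ i))).mul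
      (m.contDiff_psiPhase i))

lemma contDiff_energy : ContDiff ℝ 1 m.energy :=
  ContDiff.sum fun i _ =>
    (((contDiff_const.mul ((m.contDiff_err₁ i).pow 2)).div_const 2).add
      ((contDiff_const.mul (m.contDiff_err₁ i)).mul (m.contDiff_err₂ i))).add
      ((contDiff_const.mul ((m.contDiff_err₂ i).pow 2)).div_const 2)

lemma contDiff_field (γ : ℝ) : ContDiff ℝ 1 (m.field γ) := by
  refine contDiff_euclidean.2 fun j => ?_
  rcases j with (i | i) | u
  · exact m.contDiff_vel₁ i
  · exact m.contDiff_vel₂ i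
  · exact contDiff_const.add (contDiff_const.mul m.contDiff_slope)

lemma contDiff_limitShape : ContDiff ℝ 1 m.limitShape := by
  refine contDiff_euclidean.2 fun j => ?_
  rcases j with i | i
  · exact (m.contDiff_g i).of_le one_le_two
  · exact contDiff_scalarPsi ((m.contDiff_g i).of_le one_le_two)
      ((m.contDiff_r i).of_le one_le_two) (m.abs_r_lt_one i)

/-! #### Derivatives along curves -/

lemma hasDerivWithinAt_iff {z : ℝ → StateSpace n} {v : StateSpace n} {S : Set ℝ} {t : ℝ} :
    HasDerivWithinAt z v S t ↔
      (∀ i, HasDerivWithinAt (fun t => s₁ (z t) i) (s₁ v i) S t) ∧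
      (∀ i, HasDerivWithinAt (fun t => s₂ (z t) i) (s₂ v i) S t) ∧
      HasDerivWithinAt (fun t => phase (z t)) (phase v) S t := by
  have hE : HasDerivWithinAt z v S t ↔ ∀ j, HasDerivWithinAt (fun t => z t j) (v j) S t := by
    simp only [hasDerivWithinAt_iff_hasFDerivWithinAt]
    rw [hasFDerivWithinAt_euclidean]
    refine forall_congr' fun j => ?_
    refine iff_of_eq (congrArg (fun L => HasFDerivWithinAt (fun t => z t j) L S t) ?_)
    ext
    simp
  rw [hE]
  constructor
  · exact fun h => ⟨fun i => h _, fun i => h _, h _⟩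
  · rintro ⟨h1, h2, h3⟩ ((i | i) | u)
    exacts [h1 i, h2 i, h3]

section Curve

variable {z : ℝ → StateSpace n} {S : Set ℝ} {t : ℝ} {v : StateSpace n}

lemma hasDerivWithinAt_err₁ (hz : HasDerivWithinAt z v S t) (i : Fin n) :
    HasDerivWithinAt (fun t => m.err₁ (z t) i)
      (s₁ v i - m.κ i * m.r i (phase (z t)) * phase v) S t := by
  obtain ⟨h1, -, h3⟩ := hasDerivWithinAt_iff.1 hz
  exact (h1 i).sub ((m.hasDerivAt_g i _).comp_hasDerivWithinAt t h3)

lemma hasDerivWithinAt_psi (hz : HasDerivWithinAt z v S t) (i : Fin n) :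
    HasDerivWithinAt (fun t => m.psi (z t) i)
      (scalarPsiS (s₁ (z t) i) (m.r i (phase (z t))) * s₁ v i
        + m.psiPhase (z t) i * phase v) S t := by
  obtain ⟨h1, -, h3⟩ := hasDerivWithinAt_iff.1 hz
  refine (hasDerivWithinAt_scalarPsi (h1 i) ((m.hasDerivAt_r i _).comp_hasDerivWithinAt t h3)
    (m.abs_r_lt_one i _)).congr_deriv ?_
  simp only [psiPhase, Function.comp_apply]
  ring

lemma hasDerivWithinAt_err₂ (hz : HasDerivWithinAt z v S t) (i : Fin n) :
    HasDerivWithinAt (fun t => m.err₂ (z t) i)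
      (s₂ v i - (scalarPsiS (s₁ (z t) i) (m.r i (phase (z t))) * s₁ v i
        + m.psiPhase (z t) i * phase v)) S t :=
  ((hasDerivWithinAt_iff.1 hz).2.1 i).sub (m.hasDerivWithinAt_psi hz i)

/-- For `c = 1` and `w = slope`, the errors obey `e₁' = gap - κ r γ w` and `e₂' = -(b e₁ + k e₂) -
(d / b) gap - ψ_φ γ w`. Pairing with the gradient `(d e₁ + b e₂, b e₁ + k e₂)`, the `γ` terms add up
to `-γ w²`. The products `e₁ · gap` cancel, which is the purpose of the coefficient `d / b`, and
`-(k d / b - b) e₂ · gap` remains. The factor `c` admits the slowed-down fields of the existence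
proof. -/
lemma hasDerivWithinAt_energy {γ c : ℝ}
    (hz : HasDerivWithinAt z (c • m.field γ (z t)) S t) :
    HasDerivWithinAt (fun t => m.energy (z t))
      (-c * (γ * m.slope (z t) ^ 2 + m.dissipation (z t))) S t := by
  have h1 := m.hasDerivWithinAt_err₁ hz
  have h2 := m.hasDerivWithinAt_err₂ hz
  have hs : HasDerivWithinAt (fun t => m.energy (z t)) _ S t :=
    HasDerivWithinAt.fun_sum (u := Finset.univ) fun i _ =>
      (((((h1 i).pow 2).const_mul (m.d i)).div_const 2).add
        (((h1 i).const_mul (m.b i)).mul (h2 i))).add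
        ((((h2 i).pow 2).const_mul (m.k i)).div_const 2)
  refine hs.congr_deriv ?_
  have hφ : phase (c • m.field γ (z t)) = c * (1 + γ * m.slope (z t)) := rfl
  have hγ : γ * m.slope (z t) ^ 2 = ∑ i, γ * m.slope (z t) *
      ((m.d i * m.err₁ (z t) i + m.b i * m.err₂ (z t) i) * (m.κ i * m.r i (phase (z t)))
        + (m.b i * m.err₁ (z t) i + m.k i * m.err₂ (z t) i) * m.psiPhase (z t) i) := by
    rw [← Finset.mul_sum, slope]; ring
  rw [hγ, dissipation, ← Finset.sum_add_distrib, Finset.mul_sum]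
  refine Finset.sum_congr rfl fun i _ => ?_
  have hv1 : s₁ (c • m.field γ (z t)) i = c * m.vel₁ (z t) i := rfl
  have hv2 : s₂ (c • m.field γ (z t)) i = c * m.vel₂ (z t) i := rfl
  have hv : m.vel₁ (z t) i = m.gap (z t) i + m.κ i * m.r i (phase (z t)) := by
    rw [gap_eq]; ring
  have hb := (m.b_pos i).ne'
  rw [hφ, hv1, hv2, vel₂, hv]
  generalize m.slope (z t) = w
  field_simp
  norm_num
  ring

end Curve

end Model

/-! ### Estimates -/

lemma exists_pos_forall_le {ι : Type*} [Finite ι] {c : ι → ℝ} (hc : ∀ i, 0 < c i) :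
    ∃ a > 0, ∀ i, a ≤ c i := by
  rcases isEmpty_or_nonempty ι with h | h
  · exact ⟨1, one_pos, fun i => h.elim i⟩
  · obtain ⟨i, hi⟩ := Finite.exists_min c
    exact ⟨c i, hc i, hi⟩

lemma exists_pos_forall_ge {ι : Type*} [Finite ι] (c : ι → ℝ) : ∃ a > 0, ∀ i, c i ≤ a := by
  obtain ⟨a, ha⟩ := Finite.exists_le c
  exact ⟨max a 1, by positivity, fun i => (ha i).trans (le_max_left _ _)⟩

lemma exists_forall_le_of_periodic {u : ℝ → ℝ} {T : ℝ} (hT : 0 < T) (hu : Continuous u)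
    (hper : Function.Periodic u T) : ∃ φ₀, ∀ φ, u φ ≤ u φ₀ := by
  obtain ⟨φ₀, -, h⟩ := isCompact_Icc.exists_isMaxOn (nonempty_Icc.2 hT.le) hu.continuousOn
  refine ⟨φ₀, fun φ => ?_⟩
  obtain ⟨y, hy, hxy⟩ := hper.exists_mem_Ico₀ hT φ
  rw [hxy]
  exact h (Ico_subset_Icc_self hy)

/-- The smallest eigenvalue of a quadratic form is at least its determinant over its trace. -/
lemma quadratic_ge {p q s : ℝ} (h : 0 < p + s) (x y : ℝ) :
    (p * s - q ^ 2) / (p + s) * (x ^ 2 + y ^ 2) ≤ p * x ^ 2 + 2 * q * x * y + s * y ^ 2 := by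
  rw [div_mul_eq_mul_div, div_le_iff₀ h]
  -- Trace times the form minus determinant times `x² + y²` is exactly the sum of these two squares
  -- (Cayley–Hamilton).
  nlinarith [sq_nonneg (p * x + q * y), sq_nonneg (q * x + s * y)]

namespace Model

variable {n : ℕ} (m : Model n)

lemma exists_r_bound : ∃ ρ < 1, 0 ≤ ρ ∧ ∀ i φ, |m.r i φ| ≤ ρ := by
  have h : ∀ i, ∃ φ₀, ∀ φ, |m.r i φ| ≤ |m.r i φ₀| := fun i =>
    exists_forall_le_of_periodic m.T_pos (m.contDiff_r i).continuous.abs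
      ((m.r_periodic i).comp fun x => |x|)
  choose φ₀ hφ₀ using h
  obtain ⟨a, ha, hle⟩ := exists_pos_forall_le (c := fun i => 1 - |m.r i (φ₀ i)|)
    fun i => sub_pos.2 (m.abs_r_lt_one i _)
  -- The minimum with `1` keeps the bound nonnegative, also when there are no indices.
  refine ⟨1 - min a 1, ?_, ?_, fun i φ => (hφ₀ i φ).trans ?_⟩
  · have := lt_min ha one_pos
    linarith
  · linarith [min_le_right a 1]
  · linarith [hle i, min_le_left a 1]

lemma limitShape_periodic : Function.Periodic m.limitShape m.T := by
  intro φ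
  simp only [limitShape, m.g_periodic _ φ, m.r_periodic _ φ]

lemma exists_limitShape_lipschitz :
    ∃ L > 0, ∀ φ φ', ‖m.limitShape φ - m.limitShape φ'‖ ≤ L * |φ - φ'| := by
  have hd : Continuous (deriv m.limitShape) := m.contDiff_limitShape.continuous_deriv le_rfl
  have hp : Function.Periodic (fun φ => ‖deriv m.limitShape φ‖) m.T := by
    intro φ
    have h : (fun x => m.limitShape (x + m.T)) = m.limitShape := funext m.limitShape_periodic
    simp only
    rw [← deriv_comp_add_const, h]
  obtain ⟨φ₀, h⟩ := exists_forall_le_of_periodic m.T_pos hd.norm hp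
  refine ⟨‖deriv m.limitShape φ₀‖ + 1, by positivity, fun φ φ' => ?_⟩
  exact Convex.norm_image_sub_le_of_norm_deriv_le (𝕜 := ℝ)
    (fun x _ => m.contDiff_limitShape.differentiable one_ne_zero x)
    (fun x _ => (h x).trans (by linarith)) convex_univ (mem_univ φ') (mem_univ φ)

/-- The sum of the squares of all errors. -/
def errSq (z : StateSpace n) : ℝ := ∑ i, (m.err₁ z i ^ 2 + m.err₂ z i ^ 2)

lemma errSq_nonneg (z : StateSpace n) : 0 ≤ m.errSq z :=
  Finset.sum_nonneg fun i _ => by positivity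

/-- Each block with diagonal `d`, `k` and off-diagonal `b` is positive definite because `b² < k d`.
-/
lemma exists_mul_errSq_le_energy : ∃ a > 0, ∀ z, a * m.errSq z ≤ m.energy z := by
  obtain ⟨a, ha, hle⟩ := exists_pos_forall_le
    (c := fun i => (m.d i * m.k i - m.b i ^ 2) / (m.d i + m.k i)) fun i =>
      div_pos (by linarith [m.b_sq_lt i, mul_comm (m.k i) (m.d i)])
        (add_pos (m.d_pos i) (m.k_pos i))
  refine ⟨a / 2, by positivity, fun z => ?_⟩
  rw [errSq, energy, Finset.mul_sum]
  refine Finset.sum_le_sum fun i _ => ?_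
  have h1 := quadratic_ge (q := m.b i) (add_pos (m.d_pos i) (m.k_pos i)) (m.err₁ z i) (m.err₂ z i)
  have h2 := mul_le_mul_of_nonneg_right (hle i)
    (add_nonneg (sq_nonneg (m.err₁ z i)) (sq_nonneg (m.err₂ z i)))
  linarith

lemma exists_energy_le_mul_errSq : ∃ A > 0, ∀ z, m.energy z ≤ A * m.errSq z := by
  obtain ⟨A, hA, hle⟩ := exists_pos_forall_ge fun i => m.d i + m.b i + m.k i
  refine ⟨A, hA, fun z => ?_⟩
  rw [errSq, energy, Finset.mul_sum]
  refine Finset.sum_le_sum fun i _ => ?_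
  have h2 := mul_le_mul_of_nonneg_right (hle i)
    (add_nonneg (sq_nonneg (m.err₁ z i)) (sq_nonneg (m.err₂ z i)))
  refine le_trans ?_ h2
  have := mul_nonneg (m.d_pos i).le (sq_nonneg (m.err₁ z i))
  have := mul_nonneg (m.d_pos i).le (sq_nonneg (m.err₂ z i))
  have := mul_nonneg (m.k_pos i).le (sq_nonneg (m.err₁ z i))
  have := mul_nonneg (m.k_pos i).le (sq_nonneg (m.err₂ z i))
  have := mul_nonneg (m.b_pos i).le (sq_nonneg (m.err₁ z i - m.err₂ z i))
  have := mul_nonneg (m.b_pos i).le (sq_nonneg (m.err₁ z i + m.err₂ z i))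
  linarith

lemma energy_nonneg (z : StateSpace n) : 0 ≤ m.energy z := by
  obtain ⟨a, ha, h⟩ := m.exists_mul_errSq_le_energy
  exact (mul_nonneg ha.le (m.errSq_nonneg z)).trans (h z)

lemma norm_shape_sub_sq (z : StateSpace n) :
    ‖shape z - m.limitShape (phase z)‖ ^ 2 = ∑ i, (m.err₁ z i ^ 2 +
      (s₂ z i - scalarPsi (m.g i (phase z)) (m.r i (phase z))) ^ 2) := by
  rw [EuclideanSpace.norm_sq_eq, Fintype.sum_sum_type, ← Finset.sum_add_distrib]
  refine Finset.sum_congr rfl fun i _ => ?_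
  simp [shape, limitShape, err₁]

/-- The energy is equivalent to the squared distance of the shape to the desired shape. -/
lemma exists_energy_equiv : ∃ C > 0, ∀ z,
    ‖shape z - m.limitShape (phase z)‖ ^ 2 ≤ C * m.energy z ∧
      m.energy z ≤ C * ‖shape z - m.limitShape (phase z)‖ ^ 2 := by
  obtain ⟨a, ha, hlow⟩ := m.exists_mul_errSq_le_energy
  obtain ⟨A, hA, hup⟩ := m.exists_energy_le_mul_errSq
  obtain ⟨ρ, hρ, hρ0, hr⟩ := m.exists_r_bound
  set L : ℝ := 2 / (1 - ρ ^ 2) with hL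
  -- The desired `s₂` is `ψ` at `g`, whereas `e₂` uses `ψ` at `s₁`; the two differ by at most `L
  -- |e₁|`.
  have hpsi : ∀ (z : StateSpace n) i,
      (m.psi z i - scalarPsi (m.g i (phase z)) (m.r i (phase z))) ^ 2
        ≤ L ^ 2 * m.err₁ z i ^ 2 := by
    intro z i
    rw [← mul_pow, ← sq_abs, ← sq_abs (L * _)]
    refine pow_le_pow_left₀ (abs_nonneg _) ?_ 2
    refine (abs_scalarPsi_sub_le hρ (hr i _)).trans ?_
    rw [← hL, abs_mul]
    exact mul_le_mul_of_nonneg_right (le_abs_self L) (abs_nonneg _)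
  have hcomp : ∀ z, ‖shape z - m.limitShape (phase z)‖ ^ 2 ≤ (2 + 2 * L ^ 2) * m.errSq z ∧
      m.errSq z ≤ (2 + 2 * L ^ 2) * ‖shape z - m.limitShape (phase z)‖ ^ 2 := by
    intro z
    rw [norm_shape_sub_sq, errSq, Finset.mul_sum, Finset.mul_sum]
    refine ⟨Finset.sum_le_sum fun i _ => ?_, Finset.sum_le_sum fun i _ => ?_⟩
    all_goals
      have h1 := hpsi z i
      have h2 : s₂ z i = m.err₂ z i + m.psi z i := by rw [err₂]; ring
      rw [h2]
      generalize scalarPsi (m.g i (phase z)) (m.r i (phase z)) = q at *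
      generalize m.psi z i = q' at *
      generalize m.err₂ z i = y at *
      generalize m.err₁ z i = x at *
    · nlinarith [sq_nonneg (y - (q' - q)), mul_nonneg (sq_nonneg L) (sq_nonneg y), sq_nonneg x]
    · nlinarith [sq_nonneg (y + 2 * (q' - q)), sq_nonneg (y + (q' - q)),
        mul_nonneg (sq_nonneg L) (sq_nonneg (y + q' - q)), sq_nonneg x]
  set B : ℝ := 2 + 2 * L ^ 2
  have hB : 0 < B := by positivity
  refine ⟨B / a + A * B, by positivity, fun z => ⟨?_, ?_⟩⟩
  · have h1 : m.errSq z ≤ m.energy z / a := by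
      rw [le_div_iff₀ ha]; linarith [hlow z]
    calc _ ≤ B * m.errSq z := (hcomp z).1
      _ ≤ B * (m.energy z / a) := by gcongr
      _ = B / a * m.energy z := by ring
      _ ≤ _ := by
        have := m.energy_nonneg z
        gcongr
        have : 0 < A * B := by positivity
        linarith
  · calc _ ≤ A * m.errSq z := hup z
      _ ≤ A * (B * ‖shape z - m.limitShape (phase z)‖ ^ 2) := by
        gcongr; exact (hcomp z).2
      _ = A * B * ‖shape z - m.limitShape (phase z)‖ ^ 2 := by ring
      _ ≤ _ := by
        gcongr
        have : 0 < B / a := by positivity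
        linarith

/-- On a sublevel set `s₂` and `ψ` are bounded, and there `tanh` is strongly monotone, so `e₂ · gap`
dominates a multiple of `e₂²`. The form `(b e₁ + k e₂)² + μ e₂²` has determinant `b² μ > 0` and
controls both errors. The rate depends on `V₀` because `tanh` saturates. -/
lemma exists_mul_energy_le_dissipation (V₀ : ℝ) :
    ∃ α > 0, ∀ z, m.energy z ≤ V₀ → α * m.energy z ≤ m.dissipation z := by
  obtain ⟨a, ha, hlow⟩ := m.exists_mul_errSq_le_energy
  obtain ⟨A, hA, hup⟩ := m.exists_energy_le_mul_errSq
  obtain ⟨ρ, hρ, hρ0, hr⟩ := m.exists_r_bound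
  -- A common bound for `s₂ = e₂ + ψ` and `ψ`: the root bounds `e₂` and the second term bounds `ψ`.
  set S : ℝ := √(V₀ / a) + Real.artanh ρ with hS
  have hμ : ∀ i, 0 < (m.k i * m.d i / m.b i - m.b i) * (m.κ i * sechSq S) := fun i => by
    have h1 : 0 < m.k i * m.d i / m.b i - m.b i := by
      rw [sub_pos, lt_div_iff₀ (m.b_pos i), ← sq]; exact m.b_sq_lt i
    exact mul_pos h1 (mul_pos (m.κ_pos i) (sechSq_pos S))
  set μ : Fin n → ℝ := fun i => (m.k i * m.d i / m.b i - m.b i) * (m.κ i * sechSq S)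
  obtain ⟨ν, hν, hle⟩ := exists_pos_forall_le
    (c := fun i => (m.b i ^ 2 * (m.k i ^ 2 + μ i) - (m.b i * m.k i) ^ 2) /
      (m.b i ^ 2 + (m.k i ^ 2 + μ i))) fun i => by
        have := hμ i
        have := m.b_pos i
        refine div_pos ?_ (by positivity)
        have : 0 < m.b i ^ 2 * μ i := by positivity
        nlinarith
  refine ⟨ν / A, by positivity, fun z hz => ?_⟩
  have herr : m.errSq z ≤ V₀ / a := by
    rw [le_div_iff₀ ha]; linarith [hlow z]
  have hmain : ν * m.errSq z ≤ m.dissipation z := by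
    rw [errSq, dissipation, Finset.mul_sum]
    refine Finset.sum_le_sum fun i _ => ?_
    have hbi := m.b_pos i
    have hμi := hμ i
    have h1 := quadratic_ge (p := m.b i ^ 2) (q := m.b i * m.k i) (s := m.k i ^ 2 + μ i)
      (by positivity) (m.err₁ z i) (m.err₂ z i)
    have h2 := mul_le_mul_of_nonneg_right (hle i)
      (add_nonneg (sq_nonneg (m.err₁ z i)) (sq_nonneg (m.err₂ z i)))
    have hpsi : |m.psi z i| ≤ Real.artanh ρ := abs_scalarPsi_le hρ (hr i _)
    have herr2 : |m.err₂ z i| ≤ √(V₀ / a) := by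
      refine Real.abs_le_sqrt (le_trans ?_ herr)
      refine le_trans ?_ (Finset.single_le_sum
        (f := fun i => m.err₁ z i ^ 2 + m.err₂ z i ^ 2) (fun j _ => by positivity)
        (Finset.mem_univ i))
      exact le_add_of_nonneg_left (sq_nonneg _)
    have hs2 : |s₂ z i| ≤ S := by
      have : s₂ z i = m.err₂ z i + m.psi z i := by rw [err₂]; ring
      rw [this]
      exact (abs_add_le _ _).trans (add_le_add herr2 hpsi)
    have hps : |m.psi z i| ≤ S := hpsi.trans (le_add_of_nonneg_left (Real.sqrt_nonneg _))
    have h3 := sechSq_mul_sq_le hs2 hps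
    have h4 : m.κ i * sechSq S * m.err₂ z i ^ 2 ≤ m.err₂ z i * m.gap z i := by
      have h5 : m.err₂ z i * m.gap z i = m.κ i * ((s₂ z i - m.psi z i) *
          (Real.tanh (s₂ z i) - Real.tanh (m.psi z i))) / sechSq (s₁ z i) := by
        rw [err₂, gap]; ring
      rw [h5, le_div_iff₀ (sechSq_pos _)]
      have h6 : 0 ≤ m.κ i * (sechSq S * (s₂ z i - m.psi z i) ^ 2) :=
        mul_nonneg (m.κ_pos i).le (mul_nonneg (sechSq_pos S).le (sq_nonneg _))
      -- The factor `1 / sech² s₁ ≥ 1` in `gap` only helps, so no bound on `s₁` enters.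
      calc _ = m.κ i * (sechSq S * (s₂ z i - m.psi z i) ^ 2) * sechSq (s₁ z i) := by
            rw [err₂]; ring
        _ ≤ m.κ i * (sechSq S * (s₂ z i - m.psi z i) ^ 2) :=
            mul_le_of_le_one_right h6 (sechSq_le_one _)
        _ ≤ _ := mul_le_mul_of_nonneg_left h3 (m.κ_pos i).le
    have h7 : 0 < m.k i * m.d i / m.b i - m.b i := by
      rw [sub_pos, lt_div_iff₀ (m.b_pos i), ← sq]; exact m.b_sq_lt i
    have h8 := mul_le_mul_of_nonneg_left h4 h7.le
    have h9 : (m.k i * m.d i / m.b i - m.b i) * (m.κ i * sechSq S * m.err₂ z i ^ 2)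
        = μ i * m.err₂ z i ^ 2 := by ring
    linarith
  calc ν / A * m.energy z ≤ ν / A * (A * m.errSq z) := by gcongr; exact hup z
    _ = ν * m.errSq z := by field_simp
    _ ≤ _ := hmain

lemma dissipation_nonneg (z : StateSpace n) : 0 ≤ m.dissipation z := by
  obtain ⟨α, hα, h⟩ := m.exists_mul_energy_le_dissipation (m.energy z)
  exact (mul_nonneg hα.le (m.energy_nonneg z)).trans (h z le_rfl)

end Model

/-! ### Geometry of the state space -/

section Geometry

variable {n : ℕ}

lemma norm_sq_eq_shape_phase (z : StateSpace n) : ‖z‖ ^ 2 = ‖shape z‖ ^ 2 + phase z ^ 2 := by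
  simp only [EuclideanSpace.norm_sq_eq, Fintype.sum_sum_type, Real.norm_eq_abs, sq_abs]
  simp [shape, s₁, s₂, phase]

lemma norm_shape_le (z : StateSpace n) : ‖shape z‖ ≤ ‖z‖ := by
  refine abs_le_of_sq_le_sq' ?_ (norm_nonneg z) |>.2
  rw [norm_sq_eq_shape_phase]
  exact le_add_of_nonneg_right (sq_nonneg _)

lemma abs_phase_le (z : StateSpace n) : |phase z| ≤ ‖z‖ := by
  refine abs_le_of_sq_le_sq ?_ (norm_nonneg z)
  rw [norm_sq_eq_shape_phase]
  exact le_add_of_nonneg_left (sq_nonneg _)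

lemma norm_le_shape_add_phase (z : StateSpace n) : ‖z‖ ≤ ‖shape z‖ + |phase z| := by
  refine abs_le_of_sq_le_sq' ?_ (by positivity) |>.2
  rw [norm_sq_eq_shape_phase, add_sq, sq_abs]
  have : 0 ≤ 2 * ‖shape z‖ * |phase z| := by positivity
  linarith

lemma shape_sub (z w : StateSpace n) : shape (z - w) = shape z - shape w := by
  ext j; cases j <;> rfl

end Geometry

/-! ### Periodicity in the phase, global solutions and decay of the energy -/

namespace Model

variable {n : ℕ} (m : Model n)

/-- The deviation of the shape from the desired shape at the current phase. -/
def shapeErr (z : StateSpace n) : ShapeSpace n := shape z - m.limitShape (phase z)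

/-- The shape is within a bounded distance of the curve `limitShape`, which is bounded by
periodicity. The phase itself is not controlled by the energy. -/
lemma exists_shape_bound (V₀ : ℝ) : ∃ R, ∀ z, m.energy z ≤ V₀ → ‖shape z‖ ≤ R := by
  obtain ⟨C, hC, h⟩ := m.exists_energy_equiv
  obtain ⟨φ₀, hφ₀⟩ := exists_forall_le_of_periodic m.T_pos m.contDiff_limitShape.continuous.norm
    (m.limitShape_periodic.comp fun x => ‖x‖)
  refine ⟨√(C * V₀) + ‖m.limitShape φ₀‖, fun z hz => ?_⟩
  have h1 : ‖shape z - m.limitShape (phase z)‖ ≤ √(C * V₀) :=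
    Real.le_sqrt_of_sq_le ((h z).1.trans (by gcongr))
  calc ‖shape z‖ = ‖(shape z - m.limitShape (phase z)) + m.limitShape (phase z)‖ := by simp
    _ ≤ _ := (norm_add_le _ _).trans (add_le_add h1 (hφ₀ _))

/-- Continuous functions that are periodic in the phase are bounded on bounded sets of shapes. -/
lemma exists_bound_of_phase_periodic {F : StateSpace n → ℝ} (hF : Continuous F)
    (hper : ∀ x φ, F (mkState x (φ + m.T)) = F (mkState x φ)) (R : ℝ) :
    ∃ M > 0, ∀ z, ‖shape z‖ ≤ R → |F z| ≤ M := by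
  obtain ⟨M, hM⟩ := (isCompact_closedBall (0 : StateSpace n) (R + m.T)).exists_bound_of_continuousOn
    hF.continuousOn
  refine ⟨max M 1, by positivity, fun z hz => ?_⟩
  obtain ⟨y, hy, hxy⟩ := Function.Periodic.exists_mem_Ico₀ (f := fun φ => F (mkState (shape z) φ))
    (fun φ => hper _ φ) m.T_pos (phase z)
  simp only [mkState_shape] at hxy
  rw [hxy]
  refine (hM _ (mem_closedBall_zero_iff.2 ?_)).trans (le_max_left _ _)
  refine (norm_le_shape_add_phase _).trans ?_
  rw [shape_mkState, phase_mkState, abs_of_nonneg hy.1]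
  exact add_le_add hz hy.2.le

lemma slope_periodic (x : ShapeSpace n) (φ : ℝ) :
    m.slope (mkState x (φ + m.T)) = m.slope (mkState x φ) := by
  have hd : ∀ i, deriv (m.r i) (φ + m.T) = deriv (m.r i) φ := fun i => by
    rw [← deriv_comp_add_const]
    exact congrArg (fun u => deriv u φ) (funext (m.r_periodic i))
  have h1 : s₁ (mkState x (φ + m.T)) = s₁ (mkState x φ) := rfl
  have h2 : s₂ (mkState x (φ + m.T)) = s₂ (mkState x φ) := rfl
  simp only [slope, err₁, err₂, psi, psiPhase, phase_mkState, h1, h2, m.g_periodic _ φ,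
    m.r_periodic _ φ, hd]

lemma energy_periodic (x : ShapeSpace n) (φ : ℝ) :
    m.energy (mkState x (φ + m.T)) = m.energy (mkState x φ) := by
  have h1 : s₁ (mkState x (φ + m.T)) = s₁ (mkState x φ) := rfl
  have h2 : s₂ (mkState x (φ + m.T)) = s₂ (mkState x φ) := rfl
  simp only [energy, err₁, err₂, psi, phase_mkState, h1, h2, m.g_periodic _ φ,
    m.r_periodic _ φ]

/-- The energy decreases along the solutions of slowed down fields. -/
lemma energy_antitoneOn {γ : ℝ} (hγ : 0 ≤ γ) {c : ℝ → ℝ} {z : ℝ → StateSpace n} {S : Set ℝ}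
    (hS : Convex ℝ S) (hc : ∀ t, 0 ≤ c t)
    (hz : ∀ t ∈ S, HasDerivWithinAt z (c t • m.field γ (z t)) S t) :
    AntitoneOn (fun t => m.energy (z t)) S := by
  refine antitoneOn_of_hasDerivWithinAt_nonpos hS
    (fun t ht => (m.hasDerivWithinAt_energy (hz t ht)).continuousWithinAt)
    (fun t ht => (m.hasDerivWithinAt_energy (hz t (interior_subset ht))).mono interior_subset)
    fun t ht => ?_
  have h1 := m.dissipation_nonneg (z t)
  have h2 : 0 ≤ γ * m.slope (z t) ^ 2 := by positivity
  have := mul_nonneg (hc t) (add_nonneg h2 h1)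
  linarith

/-- The energy decreases for every slowed-down field, so the shape has a bound independent of the
cutoff. The phase velocity is then bounded by periodicity, and the phase grows at most linearly. -/
theorem exists_isSolution {γ : ℝ} (hγ : 0 ≤ γ) (z₀ : StateSpace n) :
    ∃ z : ℝ → StateSpace n, z 0 = z₀ ∧ IsSolution (m.field γ) z := by
  refine exists_isSolution_of_bounded (m.contDiff_field γ) z₀ fun N => ?_
  obtain ⟨R, hR⟩ := m.exists_shape_bound (m.energy z₀)
  obtain ⟨M, hM0, hM⟩ := m.exists_bound_of_phase_periodic
    (F := fun z => 1 + γ * m.slope z)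
    (continuous_const.add (continuous_const.mul m.contDiff_slope.continuous))
    (fun x φ => by simp only [m.slope_periodic]) R
  refine ⟨R + (|phase z₀| + M * |N|), fun c z hc h0 hz t ht => ?_⟩
  have hen : ∀ s ∈ Icc 0 N, m.energy (z s) ≤ m.energy z₀ := fun s hs => by
    have := m.energy_antitoneOn hγ (convex_Icc 0 N) (c := fun s => c (z s)) (fun s => (hc _).1) hz
      (left_mem_Icc.2 (hs.1.trans hs.2)) hs hs.1
    simpa [h0] using this
  have hphase : |phase (z t) - phase (z 0)| ≤ M * |t - 0| :=
    Convex.norm_image_sub_le_of_norm_hasDerivWithin_le (f := fun t => phase (z t))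
      (fun s hs => (hasDerivWithinAt_iff.1 (hz s hs)).2.2)
      (fun s hs => by
        change ‖c (z s) * (1 + γ * m.slope (z s))‖ ≤ M
        rw [norm_mul, Real.norm_of_nonneg (hc _).1]
        refine (mul_le_of_le_one_left (norm_nonneg _) (hc _).2).trans ?_
        exact hM _ (hR _ (hen s hs)))
      (convex_Icc 0 N) (left_mem_Icc.2 (ht.1.trans ht.2)) ht
  refine (norm_le_shape_add_phase _).trans (add_le_add (hR _ (hen t ht)) ?_)
  have h1 : M * |t - 0| ≤ M * |N| := by
    refine mul_le_mul_of_nonneg_left ?_ hM0.le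
    rw [sub_zero, abs_of_nonneg ht.1]
    exact ht.2.trans (le_abs_self N)
  rw [h0] at hphase
  have h2 := abs_add_le (phase (z t) - phase z₀) (phase z₀)
  rw [sub_add_cancel] at h2
  linarith

section Solution

variable {m} {γ : ℝ} {z : ℝ → StateSpace n}

lemma energy_le_of_isSolution (hγ : 0 ≤ γ) (hz : IsSolution (m.field γ) z) {t₀ t : ℝ}
    (h0 : 0 ≤ t₀) (ht : t₀ ≤ t) : m.energy (z t) ≤ m.energy (z t₀) :=
  m.energy_antitoneOn hγ (convex_Ici 0) (c := fun _ => 1) (fun _ => zero_le_one)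
    (fun t ht => by simpa using hz t ht) h0 (h0.trans ht) ht

lemma hasDerivWithinAt_energy_of_isSolution (hz : IsSolution (m.field γ) z) {t : ℝ}
    (ht : 0 ≤ t) : HasDerivWithinAt (fun t => m.energy (z t))
      (-1 * (γ * m.slope (z t) ^ 2 + m.dissipation (z t))) (Ici 0) t :=
  m.hasDerivWithinAt_energy (c := 1) (by simpa using hz t ht)

/-- The solution never leaves its initial sublevel set, so one rate `α` serves for all times and `V
e^{α t}` is nonincreasing. -/
lemma tendsto_energy (hγ : 0 ≤ γ) (hz : IsSolution (m.field γ) z) :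
    Tendsto (fun t => m.energy (z t)) atTop (𝓝 0) := by
  obtain ⟨α, hα, hdis⟩ := m.exists_mul_energy_le_dissipation (m.energy (z 0))
  have hd : ∀ t ∈ Ici (0 : ℝ), HasDerivWithinAt (fun t => m.energy (z t))
      (-1 * (γ * m.slope (z t) ^ 2 + m.dissipation (z t))) (Ici 0) t := fun t ht =>
    hasDerivWithinAt_energy_of_isSolution hz ht
  have hexp : ∀ t, HasDerivAt (fun t => Real.exp (α * t)) (Real.exp (α * t) * α) t := fun t => by
    simpa using ((hasDerivAt_id t).const_mul α).exp
  have hanti : AntitoneOn (fun t => m.energy (z t) * Real.exp (α * t)) (Ici 0) := by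
    refine antitoneOn_of_hasDerivWithinAt_nonpos (convex_Ici 0)
      (fun t ht => ((hd t ht).mul (hexp t).hasDerivWithinAt).continuousWithinAt)
      (fun t ht => ((hd t (interior_subset ht)).mul (hexp t).hasDerivWithinAt).mono
        interior_subset) fun t ht => ?_
    have h1 := hdis (z t) (energy_le_of_isSolution hγ hz le_rfl (interior_subset ht))
    have h2 : 0 ≤ γ * m.slope (z t) ^ 2 := by positivity
    have h3 := Real.exp_pos (α * t)
    nlinarith
  have hle : ∀ t ∈ Ici (0 : ℝ), m.energy (z t) ≤ m.energy (z 0) * Real.exp (-(α * t)) := by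
    intro t ht
    have := hanti self_mem_Ici ht ht
    simp only [mul_zero, Real.exp_zero, mul_one] at this
    rw [Real.exp_neg, ← div_eq_mul_inv, le_div_iff₀ (Real.exp_pos _)]
    exact this
  have hlim : Tendsto (fun t => m.energy (z 0) * Real.exp (-(α * t))) atTop (𝓝 0) := by
    have := (Real.tendsto_exp_neg_atTop_nhds_zero.comp
      (tendsto_id.const_mul_atTop hα)).const_mul (m.energy (z 0))
    simpa using this
  refine tendsto_of_tendsto_of_tendsto_of_le_of_le' tendsto_const_nhds hlim
    (Eventually.of_forall fun t => m.energy_nonneg _) ?_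
  filter_upwards [eventually_ge_atTop 0] with t ht using hle t ht

lemma isBounded_shape (hγ : 0 ≤ γ) (hz : IsSolution (m.field γ) z) :
    Bornology.IsBounded ((fun t => shape (z t)) '' Ici 0) := by
  obtain ⟨R, hR⟩ := m.exists_shape_bound (m.energy (z 0))
  refine isBounded_iff_forall_norm_le.2 ⟨R, ?_⟩
  rintro _ ⟨t, ht, rfl⟩
  exact hR _ (energy_le_of_isSolution hγ hz le_rfl ht)

lemma tendsto_shapeErr (hγ : 0 ≤ γ) (hz : IsSolution (m.field γ) z) :
    Tendsto (fun t => m.shapeErr (z t)) atTop (𝓝 0) := by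
  obtain ⟨C, hC, h⟩ := m.exists_energy_equiv
  rw [tendsto_zero_iff_norm_tendsto_zero]
  have h1 : Tendsto (fun t => √(C * m.energy (z t))) atTop (𝓝 0) := by
    have := ((tendsto_energy hγ hz).const_mul C).sqrt
    simpa using this
  exact squeeze_zero (fun t => norm_nonneg _) (fun t => Real.le_sqrt_of_sq_le (h _).1) h1

end Solution

/-- The energy is nonincreasing and equivalent to the squared shape error; neither fact loses a
constant depending on `γ` or on the solution. -/
lemma exists_shapeErr_le : ∃ C > 0, ∀ γ ≥ 0, ∀ z, IsSolution (m.field γ) z →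
    ∀ t₀ ≥ 0, ∀ t ≥ t₀, ‖m.shapeErr (z t)‖ ≤ C * ‖m.shapeErr (z t₀)‖ := by
  obtain ⟨C, hC, h⟩ := m.exists_energy_equiv
  refine ⟨C, hC, fun γ hγ z hz t₀ h0 t ht => ?_⟩
  refine abs_le_of_sq_le_sq' ?_ (by positivity) |>.2
  calc ‖m.shapeErr (z t)‖ ^ 2 ≤ C * m.energy (z t) := (h _).1
    _ ≤ C * m.energy (z t₀) := by
      gcongr; exact energy_le_of_isSolution hγ hz h0 ht
    _ ≤ C * (C * ‖m.shapeErr (z t₀)‖ ^ 2) := by gcongr; exact (h _).2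
    _ = _ := by ring

/-! #### The desired trajectory -/

/-- The desired trajectory in the state space. -/
def limitState (τ : ℝ) : StateSpace n := mkState (m.limitShape τ) τ

lemma err₁_limitState (τ : ℝ) (i : Fin n) : m.err₁ (m.limitState τ) i = 0 := sub_self _

lemma err₂_limitState (τ : ℝ) (i : Fin n) : m.err₂ (m.limitState τ) i = 0 := sub_self _

lemma slope_limitState (τ : ℝ) : m.slope (m.limitState τ) = 0 := by
  simp [slope, err₁_limitState, err₂_limitState]

lemma energy_limitState (τ : ℝ) : m.energy (m.limitState τ) = 0 := by
  simp [energy, err₁_limitState, err₂_limitState]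

/-- With zero errors both `gap` and `slope` vanish. So the phase runs at unit speed for every `γ`,
and the velocity of `s₂` reduces to the chain rule for `ψ (g τ, r τ)`. -/
lemma hasDerivAt_limitState (γ τ : ℝ) :
    HasDerivAt m.limitState (m.field γ (m.limitState τ)) τ := by
  have hgap : ∀ i, m.gap (m.limitState τ) i = 0 := fun i => by
    have : s₂ (m.limitState τ) i = m.psi (m.limitState τ) i := rfl
    rw [gap, this, sub_self, mul_zero, zero_div]
  have hvel : ∀ i, m.vel₁ (m.limitState τ) i = m.κ i * m.r i τ := fun i =>
    sub_eq_zero.1 ((m.gap_eq _ i).symm.trans (hgap i))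
  rw [← hasDerivWithinAt_univ, hasDerivWithinAt_iff]
  refine ⟨fun i => ?_, fun i => ?_, ?_⟩
  · exact (m.hasDerivAt_g i τ).hasDerivWithinAt.congr_deriv (hvel i).symm
  · refine (hasDerivWithinAt_scalarPsi (m.hasDerivAt_g i τ).hasDerivWithinAt
      (m.hasDerivAt_r i τ).hasDerivWithinAt (m.abs_r_lt_one i τ)).congr_deriv ?_
    change _ = m.vel₂ (m.limitState τ) i
    rw [vel₂, hgap, hvel, err₁_limitState, err₂_limitState]
    change _ = scalarPsiR (m.g i τ) (m.r i τ) * deriv (m.r i) τ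
      + scalarPsiS (m.g i τ) (m.r i τ) * _ - _ - _ - _
    ring
  · refine (hasDerivWithinAt_id τ univ).congr_deriv ?_
    change 1 = 1 + γ * m.slope (m.limitState τ)
    rw [slope_limitState, mul_zero, add_zero]

lemma isSolution_limitState_add (γ φ₀ : ℝ) :
    IsSolution (m.field γ) fun t => m.limitState (t + φ₀) := fun t _ =>
  ((m.hasDerivAt_limitState γ (t + φ₀)).comp_add_const t φ₀).hasDerivWithinAt

lemma isSolution_limitState (γ : ℝ) : IsSolution (m.field γ) m.limitState := fun t _ =>
  (m.hasDerivAt_limitState γ t).hasDerivWithinAt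

/-- The shape error is measured at the state's own phase; comparison with another phase `τ` costs
the Lipschitz constant of `limitShape`. The choice `τ = phase z` bounds the distance to the orbit by
the shape error. -/
lemma exists_norm_sub_limitState_le : ∃ L > 0, ∀ z τ,
    ‖z - m.limitState τ‖ ≤ ‖m.shapeErr z‖ + L * |phase z - τ| ∧
      ‖m.shapeErr z‖ ≤ L * ‖z - m.limitState τ‖ := by
  obtain ⟨L, hL, hlip⟩ := m.exists_limitShape_lipschitz
  refine ⟨L + 1, by positivity, fun z τ => ?_⟩
  have hl := hlip (phase z) τ
  have hs : shape (z - m.limitState τ) = shape z - m.limitShape τ := by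
    rw [shape_sub, limitState, shape_mkState]
  have hp : phase (z - m.limitState τ) = phase z - τ := rfl
  have he : shape z - m.limitShape τ = m.shapeErr z + (m.limitShape (phase z) - m.limitShape τ) := by
    rw [shapeErr]; abel
  constructor
  · refine (norm_le_shape_add_phase _).trans ?_
    rw [hs, hp, he]
    have := norm_add_le (m.shapeErr z) (m.limitShape (phase z) - m.limitShape τ)
    linarith
  · have h1 := norm_shape_le (z - m.limitState τ)
    have h2 := abs_phase_le (z - m.limitState τ)
    rw [hs] at h1
    rw [hp] at h2
    have h3 : m.shapeErr z = shape z - m.limitShape τ - (m.limitShape (phase z) - m.limitShape τ) := by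
      rw [shapeErr]; abel
    have h4 := norm_sub_le (shape z - m.limitShape τ) (m.limitShape (phase z) - m.limitShape τ)
    rw [← h3] at h4
    have h5 := mul_le_mul_of_nonneg_left h2 hL.le
    linarith

lemma phase_of_gain_zero {z : ℝ → StateSpace n} (hz : IsSolution (m.field 0) z) {t₀ t : ℝ}
    (h0 : 0 ≤ t₀) (ht : t₀ ≤ t) : phase (z t) - t = phase (z t₀) - t₀ := by
  have hd : ∀ s ∈ Ici (0 : ℝ), HasDerivWithinAt (fun s => phase (z s) - s) 0 (Ici 0) s := by
    intro s hs
    have h := ((hasDerivWithinAt_iff.1 (hz s hs)).2.2).sub (hasDerivWithinAt_id s (Ici 0))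
    refine h.congr_deriv ?_
    change 1 + 0 * m.slope (z s) - 1 = 0
    ring
  have := Convex.norm_image_sub_le_of_norm_hasDerivWithin_le (C := 0) hd (by simp)
    (convex_Ici 0) h0 (h0.trans ht)
  rw [zero_mul, norm_le_zero_iff, sub_eq_zero] at this
  exact this

theorem stableTrajectory_limitState (φ₀ : ℝ) :
    StableTrajectory (m.field 0) fun t => m.limitState (t + φ₀) := by
  obtain ⟨L, hL, hn⟩ := m.exists_norm_sub_limitState_le
  obtain ⟨C, hC, hC'⟩ := m.exists_shapeErr_le
  intro ε hε t₀ ht₀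
  refine ⟨ε / (C * L + L), by positivity, fun z hz h t ht => ?_⟩
  rw [lt_div_iff₀ (by positivity)] at h
  refine (hn (z t) (t + φ₀)).1.trans_lt ?_
  have h1 := hC' 0 le_rfl z hz t₀ ht₀ t ht
  have h2 := (hn (z t₀) (t₀ + φ₀)).2
  have h3 : phase (z t) - (t + φ₀) = phase (z t₀ - m.limitState (t₀ + φ₀)) := by
    change _ = phase (z t₀) - (t₀ + φ₀)
    linarith [m.phase_of_gain_zero hz ht₀ ht]
  have h4 := abs_phase_le (z t₀ - m.limitState (t₀ + φ₀))
  rw [h3]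
  calc _ ≤ C * (L * ‖z t₀ - m.limitState (t₀ + φ₀)‖) + L * ‖z t₀ - m.limitState (t₀ + φ₀)‖ := by
        gcongr; exact h1.trans (by gcongr)
    _ = ‖z t₀ - m.limitState (t₀ + φ₀)‖ * (C * L + L) := by ring
    _ < ε := h

theorem tendsto_sub_limitState {z : ℝ → StateSpace n} (hz : IsSolution (m.field 0) z) :
    Tendsto (fun t => z t - m.limitState (t + phase (z 0))) atTop (𝓝 0) := by
  obtain ⟨L, hL, hn⟩ := m.exists_norm_sub_limitState_le
  rw [tendsto_zero_iff_norm_tendsto_zero]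
  refine tendsto_of_tendsto_of_tendsto_of_le_of_le' tendsto_const_nhds
    (tendsto_zero_iff_norm_tendsto_zero.1 (tendsto_shapeErr le_rfl hz))
    (Eventually.of_forall fun t => norm_nonneg _) ?_
  filter_upwards [eventually_ge_atTop 0] with t ht
  have h1 := m.phase_of_gain_zero hz le_rfl ht
  have h2 : phase (z t) - (t + phase (z 0)) = 0 := by linarith
  simpa [h2] using (hn (z t) (t + phase (z 0))).1

theorem orbitallyStable_limitState {γ : ℝ} (hγ : 0 ≤ γ) :
    OrbitallyStable (m.field γ) (range m.limitState) := by
  obtain ⟨L, hL, hn⟩ := m.exists_norm_sub_limitState_le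
  obtain ⟨C, hC, hC'⟩ := m.exists_shapeErr_le
  intro ε hε t₀ ht₀
  refine ⟨ε / (C * L), by positivity, fun z hz h t ht => ?_⟩
  obtain ⟨_, ⟨τ, rfl⟩, hτ⟩ := (Metric.infDist_lt_iff (range_nonempty _)).1 h
  rw [dist_eq_norm, lt_div_iff₀ (by positivity)] at hτ
  refine (Metric.infDist_le_dist_of_mem (mem_range_self (phase (z t)))).trans_lt ?_
  rw [dist_eq_norm]
  have h1 := (hn (z t) (phase (z t))).1
  rw [sub_self, abs_zero, mul_zero, add_zero] at h1
  calc _ ≤ C * ‖m.shapeErr (z t₀)‖ := h1.trans (hC' γ hγ z hz t₀ ht₀ t ht)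
    _ ≤ C * (L * ‖z t₀ - m.limitState τ‖) := by gcongr; exact (hn _ _).2
    _ = ‖z t₀ - m.limitState τ‖ * (C * L) := by ring
    _ < ε := hτ

theorem globallyAttracting_limitState {γ : ℝ} (hγ : 0 ≤ γ) :
    GloballyAttracting (m.field γ) (range m.limitState) := by
  obtain ⟨L, hL, hn⟩ := m.exists_norm_sub_limitState_le
  intro z hz
  refine squeeze_zero (fun t => Metric.infDist_nonneg) (fun t => ?_)
    (tendsto_zero_iff_norm_tendsto_zero.1 (tendsto_shapeErr hγ hz))
  refine (Metric.infDist_le_dist_of_mem (mem_range_self (phase (z t)))).trans ?_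
  rw [dist_eq_norm]
  simpa using (hn (z t) (phase (z t))).1

theorem tendsto_infDist_shape {γ : ℝ} (hγ : 0 ≤ γ) {z : ℝ → StateSpace n}
    (hz : IsSolution (m.field γ) z) :
    Tendsto (fun t => Metric.infDist (shape (z t)) (range m.limitShape)) atTop (𝓝 0) := by
  refine squeeze_zero (fun t => Metric.infDist_nonneg) (fun t => ?_)
    (tendsto_zero_iff_norm_tendsto_zero.1 (tendsto_shapeErr hγ hz))
  refine (Metric.infDist_le_dist_of_mem (mem_range_self (phase (z t)))).trans ?_
  rw [dist_eq_norm, shapeErr]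

end Model

/-! ### High gain -/

namespace Model

variable {n : ℕ} (m : Model n)

/-- The state with phase `τ + u` and shape at offset `v` from the desired shape at phase `τ`. -/
def perturbed (q : ℝ × ℝ × ShapeSpace n) : StateSpace n :=
  mkState (m.limitShape q.1 + q.2.2) (q.1 + q.2.1)

lemma continuous_mkState {X : Type*} [TopologicalSpace X] {a : X → ShapeSpace n} {φ : X → ℝ}
    (ha : Continuous a) (hφ : Continuous φ) : Continuous fun x => mkState (a x) (φ x) := by
  refine (PiLp.continuous_toLp 2 _).comp (continuous_pi fun j => ?_)
  rcases j with j | u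
  · exact (PiLp.continuous_apply 2 _ j).comp ha
  · exact hφ

lemma continuous_perturbed : Continuous m.perturbed :=
  continuous_mkState
    ((m.contDiff_limitShape.continuous.comp continuous_fst).add continuous_snd.snd)
    (continuous_fst.add continuous_snd.fst)

lemma perturbed_add_period (τ u : ℝ) (v : ShapeSpace n) :
    m.perturbed (τ + m.T, u, v) = mkState (m.limitShape τ + v) (τ + u + m.T) := by
  simp only [perturbed, m.limitShape_periodic τ, add_right_comm]

lemma perturbed_sub (x : ShapeSpace n) (τ φ : ℝ) :
    m.perturbed (τ, φ - τ, x - m.limitShape τ) = mkState x φ := by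
  simp [perturbed]

lemma perturbed_zero (τ : ℝ) : m.perturbed (τ, 0, 0) = m.limitState τ := by
  simp [perturbed, limitState]

/-- A continuous positive function that is periodic in the base phase is bounded below. -/
lemma exists_pos_le_of_pos {F : ℝ × ℝ × ShapeSpace n → ℝ} (hF : Continuous F)
    (hper : ∀ τ u v, F (τ + m.T, u, v) = F (τ, u, v)) {ρ : ℝ}
    (hpos : ∀ τ u v, |u| ≤ ρ → ‖v‖ ≤ 1 → 0 < F (τ, u, v)) :
    ∃ c > 0, ∀ τ u v, |u| ≤ ρ → ‖v‖ ≤ 1 → c ≤ F (τ, u, v) := by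
  obtain ⟨c, hc, h⟩ := (isCompact_Icc.prod ((isCompact_Icc (a := -ρ) (b := ρ)).prod
    (isCompact_closedBall (0 : ShapeSpace n) 1))).exists_forall_le' (s := Icc 0 m.T ×ˢ _)
    hF.continuousOn (a := 0) (by
      rintro ⟨τ, u, v⟩ ⟨-, hu, hv⟩
      exact hpos τ u v (abs_le.2 hu) (mem_closedBall_zero_iff.1 hv))
  refine ⟨c, hc, fun τ u v hu hv => ?_⟩
  obtain ⟨y, hy, hxy⟩ := Function.Periodic.exists_mem_Ico₀ (f := fun τ => F (τ, u, v))
    (fun τ => hper τ u v) m.T_pos τ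
  rw [hxy]
  exact h (y, u, v) ⟨Ico_subset_Icc_self hy, abs_le.1 hu, mem_closedBall_zero_iff.2 hv⟩

/-- The derivative of `slope` in the phase. -/
def slopeDeriv (z : StateSpace n) : ℝ := deriv (fun φ => m.slope (mkState (shape z) φ)) (phase z)

lemma hasDerivAt_mkState (x : ShapeSpace n) (φ : ℝ) :
    HasDerivAt (fun φ => mkState x φ) (mkState 0 1) φ := by
  rw [← hasDerivWithinAt_univ, hasDerivWithinAt_iff]
  exact ⟨fun i => hasDerivWithinAt_const _ _ _, fun i => hasDerivWithinAt_const _ _ _,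
    hasDerivWithinAt_id _ _⟩

lemma hasDerivAt_slope_mkState (x : ShapeSpace n) (φ : ℝ) :
    HasDerivAt (fun φ => m.slope (mkState x φ)) (fderiv ℝ m.slope (mkState x φ) (mkState 0 1)) φ :=
  ((m.contDiff_slope.differentiable one_ne_zero _).hasFDerivAt).comp_hasDerivAt φ
    (hasDerivAt_mkState x φ)

lemma continuous_slopeDeriv : Continuous m.slopeDeriv := by
  have : m.slopeDeriv = fun z => fderiv ℝ m.slope z (mkState 0 1) := by
    funext z
    rw [slopeDeriv, (m.hasDerivAt_slope_mkState _ _).deriv, mkState_shape]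
  rw [this]
  exact (m.contDiff_slope.continuous_fderiv one_ne_zero).clm_apply continuous_const

lemma slopeDeriv_periodic (x : ShapeSpace n) (φ : ℝ) :
    m.slopeDeriv (mkState x (φ + m.T)) = m.slopeDeriv (mkState x φ) := by
  simp only [slopeDeriv, shape_mkState, phase_mkState]
  rw [← deriv_comp_add_const]
  simp only [m.slope_periodic]

/-- This is minus the second phase derivative of the energy at a point of zero energy. Only products
of first derivatives of the errors survive, namely `-κ r` and `-ψ_φ`, and they enter a positive
definite form; `ψ_φ` is a positive multiple of `r'`. -/
lemma slopeDeriv_limitState_neg {τ : ℝ} (h : ∃ i, m.r i τ ≠ 0 ∨ deriv (m.r i) τ ≠ 0) :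
    m.slopeDeriv (m.limitState τ) < 0 := by
  set w := m.limitState τ with hw
  have hz : HasDerivWithinAt (fun φ => mkState (m.limitShape τ) φ) (mkState 0 1) univ τ :=
    (hasDerivAt_mkState _ τ).hasDerivWithinAt
  have h1 := fun i => (m.hasDerivWithinAt_err₁ hz i).hasDerivAt univ_mem
  have h2 := fun i => (m.hasDerivWithinAt_err₂ hz i).hasDerivAt univ_mem
  have h3 := fun i => ((m.contDiff_psiPhase i).differentiable one_ne_zero _).hasFDerivAt.comp_hasDerivAt
    τ (hasDerivAt_mkState (m.limitShape τ) τ)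
  have h4 : HasDerivAt (fun φ => m.slope (mkState (m.limitShape τ) φ)) _ τ :=
    HasDerivAt.fun_sum (u := Finset.univ) fun i _ =>
      ((((h1 i).const_mul (m.d i)).add ((h2 i).const_mul (m.b i))).mul
        ((m.hasDerivAt_r i τ).const_mul (m.κ i))).add
      ((((h1 i).const_mul (m.b i)).add ((h2 i).const_mul (m.k i))).mul (h3 i))
  have hval : m.slopeDeriv w = ∑ i, -(m.d i * (m.κ i * m.r i τ) ^ 2
      + 2 * m.b i * (m.κ i * m.r i τ) * m.psiPhase w i + m.k i * m.psiPhase w i ^ 2) := by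
    change deriv (fun φ => m.slope (mkState (shape w) φ)) τ = _
    rw [hw, limitState, shape_mkState, h4.deriv]
    refine Finset.sum_congr rfl fun i _ => ?_
    have e1 : m.err₁ (mkState (m.limitShape τ) τ) i = 0 := m.err₁_limitState τ i
    have e2 : m.err₂ (mkState (m.limitShape τ) τ) i = 0 := m.err₂_limitState τ i
    have v1 : s₁ (mkState (0 : ShapeSpace n) 1) i = 0 := rfl
    have v2 : s₂ (mkState (0 : ShapeSpace n) 1) i = 0 := rfl
    have v3 : phase (mkState (0 : ShapeSpace n) 1) = 1 := rfl
    simp only [Pi.add_apply, e1, e2, v1, v2, v3, phase_mkState]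
    ring
  rw [hval]
  have hq : ∀ i, (m.d i * m.k i - m.b i ^ 2) / (m.d i + m.k i) *
      ((m.κ i * m.r i τ) ^ 2 + m.psiPhase w i ^ 2) ≤ m.d i * (m.κ i * m.r i τ) ^ 2
      + 2 * m.b i * (m.κ i * m.r i τ) * m.psiPhase w i + m.k i * m.psiPhase w i ^ 2 := fun i =>
    quadratic_ge (add_pos (m.d_pos i) (m.k_pos i)) _ _
  have hc : ∀ i, 0 < (m.d i * m.k i - m.b i ^ 2) / (m.d i + m.k i) := fun i =>
    div_pos (by linarith [m.b_sq_lt i, mul_comm (m.k i) (m.d i)])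
      (add_pos (m.d_pos i) (m.k_pos i))
  obtain ⟨i, hi⟩ := h
  refine Finset.sum_neg' (fun j _ => neg_nonpos.2 (le_trans ?_ (hq j)))
    ⟨i, Finset.mem_univ i, neg_neg_of_pos (lt_of_lt_of_le ?_ (hq i))⟩
  · exact mul_nonneg (hc j).le (by positivity)
  · refine mul_pos (hc i) ?_
    rcases hi with hi | hi
    · have := m.κ_pos i
      positivity
    · have hp : m.psiPhase w i ≠ 0 := mul_ne_zero (scalarPsiR_pos (m.abs_r_lt_one i _)).ne' hi
      positivity

/-- At a desired shape the slope vanishes only at the right phase, locally. -/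
lemma exists_slope_ne_zero (h : ∀ τ, ∃ i, m.r i τ ≠ 0 ∨ deriv (m.r i) τ ≠ 0) :
    ∃ ρ > 0, ∀ τ u, |u| ≤ ρ → u ≠ 0 → m.slope (m.perturbed (τ, u, 0)) ≠ 0 := by
  -- A sum of nonnegative functions without common zero has a positive minimum `c` by compactness;
  -- where all but one add up to at most `c / 2`, the remaining one is at least `c / 2`. The barrier
  -- and the lower bound on the slope below use the same device.
  obtain ⟨c, hc, hle⟩ := m.exists_pos_le_of_pos (ρ := 1)
    (F := fun q => |q.2.1| + ‖q.2.2‖ + max (-m.slopeDeriv (m.perturbed q)) 0)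
    ((continuous_snd.fst.abs.add continuous_snd.snd.norm).add
      ((m.continuous_slopeDeriv.comp m.continuous_perturbed).neg.max continuous_const))
    (fun τ u v => by
      simp only [perturbed_add_period, slopeDeriv_periodic]; rfl)
    (fun τ u v _ _ => by
      by_cases huv : u = 0 ∧ v = 0
      · obtain ⟨rfl, rfl⟩ := huv
        simp only [perturbed_zero]
        have := m.slopeDeriv_limitState_neg (h τ)
        simpa using this
      · have h0 : 0 < |u| + ‖v‖ := by
          rcases not_and_or.1 huv with hu | hv
          · have := abs_pos.2 hu; positivity
          · have := norm_pos_iff.2 hv; positivity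
        exact add_pos_of_pos_of_nonneg h0 (le_max_right _ _))
  refine ⟨min (c / 2) 1, by positivity, fun τ u hu hu0 hslope => ?_⟩
  set A : ℝ → ℝ := fun φ => m.slope (mkState (m.limitShape τ) φ)
  have hAd : ∀ φ, HasDerivAt A (m.slopeDeriv (mkState (m.limitShape τ) φ)) φ := fun φ => by
    have := m.hasDerivAt_slope_mkState (m.limitShape τ) φ
    rw [← this.deriv] at this
    simpa only [slopeDeriv, shape_mkState, phase_mkState] using this
  -- The slope at frozen shape is strictly decreasing in the phase near `τ`, hence vanishes only at
  -- `τ`.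
  have hanti : StrictAntiOn A (Icc (τ - min (c / 2) 1) (τ + min (c / 2) 1)) := by
    refine strictAntiOn_of_deriv_neg (convex_Icc _ _)
      (fun φ _ => (hAd φ).continuousAt.continuousWithinAt) fun φ hφ => ?_
    rw [(hAd φ).deriv]
    have hmem := mem_Icc.1 (interior_subset hφ)
    have habs : |φ - τ| ≤ min (c / 2) 1 := abs_le.2 ⟨by linarith [hmem.1], by linarith [hmem.2]⟩
    have h1 := hle τ (φ - τ) 0 (habs.trans (min_le_right _ _)) (by simp)
    have h2 := habs.trans (min_le_left _ _)
    have h3 : m.perturbed (τ, φ - τ, 0) = mkState (m.limitShape τ) φ := by simp [perturbed]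
    simp only [h3, norm_zero, add_zero] at h1
    by_contra hcon
    rw [max_eq_right (by linarith)] at h1
    linarith
  have hm : 0 < min (c / 2) 1 := by positivity
  obtain ⟨hu1, hu2⟩ := abs_le.1 hu
  have heq : A (τ + u) = A τ := by
    have h1 : A (τ + u) = m.slope (m.perturbed (τ, u, 0)) := by simp [A, perturbed]
    rw [h1, hslope]
    exact (m.slope_limitState τ).symm
  have := hanti.injOn ⟨by linarith, by linarith⟩ ⟨by linarith, by linarith⟩ heq
  exact hu0 (by linarith)

lemma slope_eq_zero_of_energy_eq_zero {z : StateSpace n} (h : m.energy z = 0) :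
    m.slope z = 0 := by
  obtain ⟨a, ha, hle⟩ := m.exists_mul_errSq_le_energy
  have h0 : m.errSq z = 0 := by
    have := hle z
    have := m.errSq_nonneg z
    nlinarith
  rw [errSq, Finset.sum_eq_zero_iff_of_nonneg fun i _ => by positivity] at h0
  refine Finset.sum_eq_zero fun i hi => ?_
  have h1 := h0 i hi
  have e1 : m.err₁ z i = 0 := by nlinarith [sq_nonneg (m.err₁ z i), sq_nonneg (m.err₂ z i)]
  have e2 : m.err₂ z i = 0 := by nlinarith [sq_nonneg (m.err₁ z i), sq_nonneg (m.err₂ z i)]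
  rw [e1, e2]
  ring

/-- There is an energy barrier at some fixed distance from the right phase. -/
lemma exists_energy_barrier {ρ : ℝ} (hρ : 0 < ρ)
    (h : ∀ τ u, |u| ≤ ρ → u ≠ 0 → m.slope (m.perturbed (τ, u, 0)) ≠ 0) :
    ∃ μ > 0, ∀ x τ φ, |φ - τ| = ρ → ‖x - m.limitShape τ‖ ≤ μ →
      μ ≤ m.energy (mkState x φ) := by
  obtain ⟨c, hc, hle⟩ := m.exists_pos_le_of_pos (ρ := ρ)
    (F := fun q => m.energy (m.perturbed q) + ‖q.2.2‖ + |(|q.2.1| - ρ)|)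
    (((m.contDiff_energy.continuous.comp m.continuous_perturbed).add continuous_snd.snd.norm).add
      (continuous_snd.fst.abs.sub continuous_const).abs)
    (fun τ u v => by
      simp only [perturbed_add_period, energy_periodic]; rfl)
    -- A common zero would have `v = 0`, `|u| = ρ` and zero energy, hence zero slope, against `h`.
    (fun τ u v hu _ => by
      have h0 := m.energy_nonneg (m.perturbed (τ, u, v))
      by_contra hcon
      have h1 := norm_nonneg v
      have h2 := abs_nonneg (|u| - ρ)
      have e1 : m.energy (m.perturbed (τ, u, v)) = 0 := by linarith
      have e2 : ‖v‖ = 0 := by linarith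
      have e3 : |(|u| - ρ)| = 0 := by linarith
      rw [norm_eq_zero] at e2
      rw [abs_eq_zero, sub_eq_zero] at e3
      subst e2
      refine h τ u hu ?_ (m.slope_eq_zero_of_energy_eq_zero e1)
      rintro rfl
      rw [abs_zero] at e3
      exact hρ.ne e3)
  refine ⟨min (c / 2) 1, by positivity, fun x τ φ hφ hx => ?_⟩
  have h1 := hle τ (φ - τ) (x - m.limitShape τ) hφ.le (hx.trans (min_le_right _ _))
  simp only [perturbed_sub, hφ, sub_self, abs_zero, add_zero] at h1
  have := hx.trans (min_le_left _ _)
  refine (min_le_left _ _).trans ?_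
  linarith

/-- Near the desired shape, the slope is bounded away from zero unless the energy is small. -/
lemma exists_slope_ge {ρ : ℝ}
    (h : ∀ τ u, |u| ≤ ρ → u ≠ 0 → m.slope (m.perturbed (τ, u, 0)) ≠ 0) {η : ℝ} (hη : 0 < η) :
    ∃ c > 0, ∀ x τ φ, |φ - τ| ≤ ρ → ‖x - m.limitShape τ‖ ≤ c →
      η ≤ m.energy (mkState x φ) → c ≤ |m.slope (mkState x φ)| := by
  obtain ⟨c, hc, hle⟩ := m.exists_pos_le_of_pos (ρ := ρ)
    (F := fun q => |m.slope (m.perturbed q)| + ‖q.2.2‖ + max (η - m.energy (m.perturbed q)) 0)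
    (((m.contDiff_slope.continuous.comp m.continuous_perturbed).abs.add
      continuous_snd.snd.norm).add
      ((continuous_const.sub (m.contDiff_energy.continuous.comp m.continuous_perturbed)).max
        continuous_const))
    (fun τ u v => by
      simp only [perturbed_add_period, energy_periodic, slope_periodic]; rfl)
    (fun τ u v hu _ => by
      by_contra hcon
      have h1 := norm_nonneg v
      have h2 := abs_nonneg (m.slope (m.perturbed (τ, u, v)))
      have h3 := le_max_right (η - m.energy (m.perturbed (τ, u, v))) 0
      have h4 := le_max_left (η - m.energy (m.perturbed (τ, u, v))) 0
      have e1 : |m.slope (m.perturbed (τ, u, v))| = 0 := by linarith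
      have e2 : ‖v‖ = 0 := by linarith
      have e3 : η ≤ m.energy (m.perturbed (τ, u, v)) := by linarith
      rw [norm_eq_zero] at e2
      rw [abs_eq_zero] at e1
      subst e2
      by_cases hu0 : u = 0
      · subst hu0
        rw [perturbed_zero, energy_limitState] at e3
        linarith
      · exact h τ u hu hu0 e1)
  refine ⟨min (c / 2) 1, by positivity, fun x τ φ hφ hx hE => ?_⟩
  have h1 := hle τ (φ - τ) (x - m.limitShape τ) hφ (hx.trans (min_le_right _ _))
  simp only [perturbed_sub, max_eq_right (sub_nonpos.2 hE), add_zero] at h1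
  have := hx.trans (min_le_left _ _)
  refine (min_le_left _ _).trans ?_
  linarith

/-- The velocity of the shape does not depend on the gain. -/
def shapeVel (z : StateSpace n) : ShapeSpace n := mkShape (m.vel₁ z) (m.vel₂ z)

/-- The bound is free of `γ`: this separates the time scale of the shape from that of the phase at
high gain. -/
lemma exists_shapeVel_bound (V₀ : ℝ) : ∃ M > 0, ∀ z, m.energy z ≤ V₀ → ‖m.shapeVel z‖ ≤ M := by
  obtain ⟨R, hR⟩ := m.exists_shape_bound V₀
  have hcont : Continuous m.shapeVel := by
    refine (PiLp.continuous_toLp 2 _).comp (continuous_pi fun j => ?_)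
    rcases j with i | i
    · exact (m.contDiff_vel₁ i).continuous
    · exact (m.contDiff_vel₂ i).continuous
  obtain ⟨M, hM0, hM⟩ := m.exists_bound_of_phase_periodic (F := fun z => ‖m.shapeVel z‖)
    hcont.norm (fun x φ => by
      have hd : ∀ i, deriv (m.r i) (φ + m.T) = deriv (m.r i) φ := fun i => by
        rw [← deriv_comp_add_const]
        exact congrArg (fun u => deriv u φ) (funext (m.r_periodic i))
      have h1 : s₁ (mkState x (φ + m.T)) = s₁ (mkState x φ) := rfl
      have h2 : s₂ (mkState x (φ + m.T)) = s₂ (mkState x φ) := rfl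
      have e1 : m.vel₁ (mkState x (φ + m.T)) = m.vel₁ (mkState x φ) := rfl
      have e2 : m.vel₂ (mkState x (φ + m.T)) = m.vel₂ (mkState x φ) := by
        funext i
        simp only [vel₂, e1, gap, err₁, err₂, psi, psiPhase, phase_mkState, h1, h2,
          m.g_periodic _ φ, m.r_periodic _ φ, hd]
      simp only [shapeVel, e1, e2]) R
  exact ⟨M, hM0, fun z hz => by simpa using hM z (hR z hz)⟩

lemma hasDerivWithinAt_shape {γ : ℝ} {z : ℝ → StateSpace n} (hz : IsSolution (m.field γ) z)
    {t : ℝ} (ht : 0 ≤ t) :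
    HasDerivWithinAt (fun t => shape (z t)) (m.shapeVel (z t)) (Ici 0) t := by
  obtain ⟨h1, h2, -⟩ := hasDerivWithinAt_iff.1 (hz t ht)
  have hE : ∀ j, HasDerivWithinAt (fun t => shape (z t) j) (m.shapeVel (z t) j) (Ici 0) t := by
    rintro (i | i)
    exacts [h1 i, h2 i]
  rw [hasDerivWithinAt_iff_hasFDerivWithinAt, hasFDerivWithinAt_euclidean]
  intro j
  refine (hE j).hasFDerivWithinAt.congr_fderiv ?_
  ext
  simp

/-- Bounds the initial energy when the shape is near the curve at a phase `τ` other than the current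
one. -/
lemma energy_le_of_shape_near : ∃ C > 0, ∃ L > 0, ∀ z τ,
    m.energy z ≤ C * (‖shape z - m.limitShape τ‖ + L * |τ - phase z|) ^ 2 := by
  obtain ⟨C, hC, h⟩ := m.exists_energy_equiv
  obtain ⟨L, hL, hlip⟩ := m.exists_limitShape_lipschitz
  refine ⟨C, hC, L, hL, fun z τ => (h z).2.trans ?_⟩
  gcongr
  rw [← sub_add_sub_cancel (shape z) (m.limitShape τ) (m.limitShape (phase z))]
  exact (norm_add_le _ _).trans (add_le_add_right (hlip _ _) _)

/-- Orbital stability of the desired shapes for high gains, in the nondegenerate case. -/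
theorem highGain_stable (h : ∀ τ, ∃ i, m.r i τ ≠ 0 ∨ deriv (m.r i) τ ≠ 0) :
    ∃ ρ > 0, ∀ ε > 0, ∃ δ > 0, ∀ᶠ γ : ℝ in atTop,
      ∀ z : ℝ → StateSpace n, IsSolution (m.field γ) z → ∀ t₀ ≥ 0,
        (∃ τ : ℝ, |τ - phase (z t₀)| < ρ ∧ ‖shape (z t₀) - m.limitShape τ‖ < δ) →
        ∀ t ≥ t₀, Metric.infDist (shape (z t)) (range m.limitShape) < ε := by
  obtain ⟨ρ', hρ', hslope⟩ := m.exists_slope_ne_zero h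
  obtain ⟨μ, hμ, hbarrier⟩ := m.exists_energy_barrier hρ' hslope
  obtain ⟨C, hC, L, hL, hnear⟩ := m.energy_le_of_shape_near
  obtain ⟨C', hC', hequiv⟩ := m.exists_energy_equiv
  obtain ⟨M, hM, hvel⟩ := m.exists_shapeVel_bound μ
  -- The initial phase error contributes less than half of `√(μ / C)`, so the initial energy lies
  -- below the barrier `μ`. No `ε` enters.
  set ρ : ℝ := min ρ' (√(μ / C) / (2 * L)) with hρdef
  have hρ : 0 < ρ := by positivity
  refine ⟨ρ, hρ, fun ε hε => ?_⟩
  -- Energy at most `η` means shape error at most `ε / 2`.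
  set η : ℝ := (ε / 2) ^ 2 / C' with hη
  obtain ⟨c, hc, hge⟩ := m.exists_slope_ge hslope (η := η) (by positivity)
  -- The permitted deviation of the shape from `limitShape τ` during the transient: small enough for
  -- the barrier, for the slope bound and for `ε`. Half is allotted to the initial offset, half to
  -- the drift.
  set σ : ℝ := min (min μ c) (ε / 2) with hσdef
  have hσ : 0 < σ := by positivity
  set δ : ℝ := min (σ / 2) (√(μ / C) / 2) with hδdef
  -- The transient: at speed at most `M` the shape drifts at most `σ / 2` in time `s`.
  set s : ℝ := σ / (2 * M) with hs
  have hs0 : 0 < s := by positivity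
  refine ⟨δ, by positivity, ?_⟩
  -- The threshold is `γ c² s ≥ μ`: decay at rate `γ c²` during time `s` would use up all the
  -- energy.
  filter_upwards [eventually_ge_atTop 0, eventually_ge_atTop (μ / (c ^ 2 * s))] with γ hγ hγ' z hz
    t₀ ht₀ ⟨τ, hτ, hx⟩ t ht
  have hstart : m.energy (z t₀) < μ := by
    refine (hnear (z t₀) τ).trans_lt ?_
    have h1 : ‖shape (z t₀) - m.limitShape τ‖ < √(μ / C) / 2 := hx.trans_le (min_le_right _ _)
    have h2 : L * |τ - phase (z t₀)| < √(μ / C) / 2 := by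
      have := hτ.trans_le (min_le_right _ _)
      rw [lt_div_iff₀ (by positivity)] at this
      linarith
    calc _ < C * √(μ / C) ^ 2 := by
          gcongr
          linarith
      _ = μ := by rw [Real.sq_sqrt (by positivity)]; field_simp
  have henergy : ∀ r ≥ t₀, m.energy (z r) < μ := fun r hr =>
    (energy_le_of_isSolution hγ hz ht₀ hr).trans_lt hstart
  have hshape : ∀ r ∈ Icc t₀ (t₀ + s), ‖shape (z r) - m.limitShape τ‖ ≤ σ := by
    intro r hr
    have h1 : ‖shape (z r) - shape (z t₀)‖ ≤ M * ‖r - t₀‖ :=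
      Convex.norm_image_sub_le_of_norm_hasDerivWithin_le (s := Ici t₀)
        (fun q hq => (m.hasDerivWithinAt_shape hz (ht₀.le.trans hq)).mono (Ici_subset_Ici.2 ht₀))
        (fun q hq => hvel _ (henergy q hq).le) (convex_Ici t₀) self_mem_Ici hr.1
    have h2 : M * ‖r - t₀‖ ≤ σ / 2 := by
      rw [Real.norm_of_nonneg (sub_nonneg.2 hr.1)]
      calc M * (r - t₀) ≤ M * s := by gcongr; linarith [hr.2]
        _ = σ / 2 := by rw [hs]; field_simp
    have h3 := hx.trans_le (min_le_left _ _)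
    rw [← sub_add_sub_cancel (shape (z r)) (shape (z t₀)) (m.limitShape τ)]
    refine (norm_add_le _ _).trans ?_
    linarith
  -- To leave, the phase would cross distance `ρ'` from `τ`, where the energy is at least `μ`; but
  -- the energy stays below `μ`.
  have hphase : ∀ r ∈ Icc t₀ (t₀ + s), |phase (z r) - τ| ≤ ρ' := by
    intro r hr
    by_contra! hcon
    have hcont : ContinuousOn (fun q => |phase (z q) - τ|) (Icc t₀ r) := fun q hq =>
      ((((hasDerivWithinAt_iff.1 (hz q (ht₀.le.trans hq.1))).2.2).continuousWithinAt.mono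
        fun q' hq' => ht₀.le.trans hq'.1).sub continuousWithinAt_const).abs
    have hlow : |phase (z t₀) - τ| ≤ ρ' := by
      rw [abs_sub_comm]
      exact hτ.le.trans (min_le_left _ _)
    obtain ⟨q, hq, hqe⟩ := intermediate_value_Icc hr.1 hcont ⟨hlow, hcon.le⟩
    have h1 := hbarrier (shape (z q)) τ (phase (z q)) hqe
      ((hshape q ⟨hq.1, hq.2.trans hr.2⟩).trans ((min_le_left _ _).trans (min_le_left _ _)))
    rw [mkState_shape] at h1
    exact (henergy q hq.1).not_ge h1
  rcases le_total t (t₀ + s) with hle | hle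
  · refine (Metric.infDist_le_dist_of_mem (mem_range_self τ)).trans_lt ?_
    rw [dist_eq_norm]
    have h1 := hshape t ⟨ht, hle⟩
    have h2 : σ ≤ ε / 2 := min_le_right _ _
    linarith
  -- If the energy exceeded `η` at the end, it would do so throughout; then `|slope| ≥ c` all along
  -- and the energy would turn negative.
  · have hend : m.energy (z (t₀ + s)) ≤ η := by
      by_contra! hcon
      have hd : ∀ r ∈ Icc t₀ (t₀ + s), HasDerivWithinAt (fun r => m.energy (z r) + γ * c ^ 2 * r)
          (-1 * (γ * m.slope (z r) ^ 2 + m.dissipation (z r)) + γ * c ^ 2) (Icc t₀ (t₀ + s)) r := by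
        intro r hr
        have h1 := (hasDerivWithinAt_energy_of_isSolution hz (ht₀.le.trans hr.1)).mono
          (fun q (hq : q ∈ Icc t₀ (t₀ + s)) => ht₀.le.trans hq.1)
        exact (h1.add ((hasDerivWithinAt_id r _).const_mul (γ * c ^ 2))).congr_deriv (by simp)
      have hanti : AntitoneOn (fun r => m.energy (z r) + γ * c ^ 2 * r) (Icc t₀ (t₀ + s)) := by
        refine antitoneOn_of_hasDerivWithinAt_nonpos (convex_Icc _ _)
          (fun r hr => (hd r hr).continuousWithinAt)
          (fun r hr => (hd r (interior_subset hr)).mono interior_subset) fun r hr => ?_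
        have hr' := interior_subset hr
        have h1 : η ≤ m.energy (z r) :=
          hcon.le.trans (energy_le_of_isSolution hγ hz (ht₀.le.trans hr'.1) hr'.2)
        have h2 := hge (shape (z r)) τ (phase (z r)) (hphase r hr')
          ((hshape r hr').trans ((min_le_left _ _).trans (min_le_right _ _)))
          (by rwa [mkState_shape])
        rw [mkState_shape] at h2
        have h3 : c ^ 2 ≤ m.slope (z r) ^ 2 := by
          rw [← sq_abs (m.slope (z r))]
          exact pow_le_pow_left₀ hc.le h2 2
        have h4 := mul_le_mul_of_nonneg_left h3 hγ
        have h5 := m.dissipation_nonneg (z r)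
        linarith
      have h1 := hanti (left_mem_Icc.2 (by linarith)) (right_mem_Icc.2 (by linarith))
        (by linarith : t₀ ≤ t₀ + s)
      simp only at h1
      rw [div_le_iff₀ (by positivity)] at hγ'
      have h2 : 0 < η := by positivity
      nlinarith
    refine (Metric.infDist_le_dist_of_mem (mem_range_self (phase (z t)))).trans_lt ?_
    rw [dist_eq_norm]
    have h1 : ‖shape (z t) - m.limitShape (phase (z t))‖ ≤ ε / 2 := by
      refine abs_le_of_sq_le_sq' ?_ (by positivity) |>.2
      refine (hequiv (z t)).1.trans ?_
      calc C' * m.energy (z t) ≤ C' * η := by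
            gcongr
            exact (energy_le_of_isSolution hγ hz (by linarith) hle).trans hend
        _ = (ε / 2) ^ 2 := by rw [hη]; field_simp
    linarith

/-- Orbital stability of the desired shapes for high gains, for a constant desired shape. -/
theorem highGain_stable_of_const (h : ∀ τ τ', m.limitShape τ = m.limitShape τ') :
    ∃ ρ > 0, ∀ ε > 0, ∃ δ > 0, ∀ᶠ γ : ℝ in atTop,
      ∀ z : ℝ → StateSpace n, IsSolution (m.field γ) z → ∀ t₀ ≥ 0,
        (∃ τ : ℝ, |τ - phase (z t₀)| < ρ ∧ ‖shape (z t₀) - m.limitShape τ‖ < δ) →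
        ∀ t ≥ t₀, Metric.infDist (shape (z t)) (range m.limitShape) < ε := by
  obtain ⟨C, hC, hC'⟩ := m.exists_shapeErr_le
  refine ⟨1, one_pos, fun ε hε => ⟨ε / C, by positivity, ?_⟩⟩
  filter_upwards [eventually_ge_atTop 0] with γ hγ z hz t₀ ht₀ ⟨τ, _, hx⟩ t ht
  refine (Metric.infDist_le_dist_of_mem (mem_range_self (phase (z t)))).trans_lt ?_
  rw [dist_eq_norm]
  refine (hC' γ hγ z hz t₀ ht₀ t ht).trans_lt ?_
  rw [h τ (phase (z t₀)), lt_div_iff₀ hC, mul_comm] at hx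
  exact hx

end Model

/-! ### Reduction to the scalar model -/

lemma inv_diagonal_of_ne_zero {ι : Type*} [Fintype ι] [DecidableEq ι] {v : ι → ℝ}
    (hv : ∀ i, v i ≠ 0) : (Matrix.diagonal v)⁻¹ = Matrix.diagonal fun i => (v i)⁻¹ := by
  refine Matrix.inv_eq_right_inv ?_
  rw [Matrix.diagonal_mul_diagonal, ← Matrix.diagonal_one]
  exact congrArg Matrix.diagonal (funext fun i => mul_inv_cancel₀ (hv i))

lemma sechMatrix_eq {n : ℕ} (c v : Fin n → ℝ) :
    sechMatrix c v = Matrix.diagonal fun i => c i * sechSq (v i) := by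
  rw [sechMatrix, Matrix.diagonal_pow, ← Matrix.diagonal_one, Matrix.diagonal_sub,
    Matrix.diagonal_mul_diagonal]
  rfl

namespace Data

variable {n : ℕ}

/-- The hypotheses on the data of the oscillator. -/
structure Admissible (p : Data n) (T : ℝ) : Prop where
  T_pos : 0 < T
  periodic : Function.Periodic p.f T
  contDiff : ContDiff ℝ 3 p.f
  qd_mem : ∀ t : ℝ, p.qd t ∈ p.Q
  bound : ∀ φ ∈ Icc (0 : ℝ) T, ∀ i : Fin n,
    p.δy i ^ 2 * |deriv p.f φ i| < |p.δy i ^ 2 - (p.f φ i - p.yAvg i) ^ 2| * p.δv i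
  B_diag : p.B.IsDiag
  K_diag : p.K.IsDiag
  D_diag : p.D.IsDiag
  B_posDef : p.B.PosDef
  K_posDef : p.K.PosDef
  D_posDef : p.D.PosDef
  KBD_posDef : (p.K * p.B⁻¹ * p.D - p.B).PosDef

namespace Admissible

variable {p : Data n} {T : ℝ} (h : p.Admissible T)

include h

lemma δy_pos (i : Fin n) : 0 < p.δy i := by
  have := h.qd_mem 0 i
  unfold δy
  linarith [this.1, this.2.1]

lemma δv_pos (i : Fin n) : 0 < p.δv i := (abs_nonneg _).trans_lt (h.qd_mem 0 i).2.2

lemma abs_f_div_lt (φ : ℝ) (i : Fin n) : |(p.f φ i - p.yAvg i) / p.δy i| < 1 := by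
  have h1 := h.qd_mem φ i
  simp only [qd, mkShape_inl] at h1
  rw [abs_div, abs_of_pos (h.δy_pos i), div_lt_one (h.δy_pos i), abs_lt, yAvg, δy]
  constructor <;> linarith [h1.1, h1.2.1]

lemma abs_deriv_div_lt (φ : ℝ) (i : Fin n) : |deriv p.f φ i / p.δv i| < 1 := by
  have h1 := (h.qd_mem φ i).2.2
  simp only [qd, mkShape_inr] at h1
  rwa [abs_div, abs_of_pos (h.δv_pos i), div_lt_one (h.δv_pos i)]

lemma gp_eq (φ : ℝ) (i : Fin n) : p.gp φ i = Real.artanh ((p.f φ i - p.yAvg i) / p.δy i) := by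
  rw [gp, inv_diagonal_of_ne_zero fun i => (h.δy_pos i).ne']
  simp only [vartanh, Matrix.mulVec_diagonal, Pi.sub_apply, div_eq_inv_mul]

lemma gv_eq (φ : ℝ) (i : Fin n) : p.gv φ i = Real.artanh (deriv p.f φ i / p.δv i) := by
  rw [gv, inv_diagonal_of_ne_zero fun i => (h.δv_pos i).ne']
  simp only [vartanh, Matrix.mulVec_diagonal, div_eq_inv_mul]

lemma tanh_gp (φ : ℝ) (i : Fin n) : Real.tanh (p.gp φ i) = (p.f φ i - p.yAvg i) / p.δy i := by
  rw [h.gp_eq, Real.tanh_artanh (abs_lt.1 (h.abs_f_div_lt φ i))]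

lemma tanh_gv (φ : ℝ) (i : Fin n) : Real.tanh (p.gv φ i) = deriv p.f φ i / p.δv i := by
  rw [h.gv_eq, Real.tanh_artanh (abs_lt.1 (h.abs_deriv_div_lt φ i))]

lemma deriv_periodic : Function.Periodic (deriv p.f) T := by
  intro φ
  rw [← deriv_comp_add_const]
  exact congrArg (fun u => deriv u φ) (funext h.periodic)

lemma gp_periodic : Function.Periodic p.gp T := by
  intro φ
  simp only [gp, h.periodic φ]

omit h in
/-- The ratio of the desired velocity of `s₁` to its bound. -/
def ratio (p : Data n) (i : Fin n) (φ : ℝ) : ℝ := deriv p.f φ i / (p.δv i * sechSq (p.gp φ i))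

lemma ratio_periodic (i : Fin n) : Function.Periodic (ratio p i) T := by
  intro φ
  simp only [ratio, h.deriv_periodic φ, h.gp_periodic φ]

/-- Since `δy² - (f - y_avg)² = δy² sech² g_p`, this is the hypothesis `bound` divided by `δy²`,
extended from one period by periodicity. -/
lemma abs_ratio_lt_one (i : Fin n) (φ : ℝ) : |ratio p i φ| < 1 := by
  obtain ⟨y, hy, hxy⟩ := (h.ratio_periodic i).exists_mem_Ico₀ h.T_pos φ
  rw [hxy]
  have h1 := h.bound y (Ico_subset_Icc_self hy) i
  have hδ := h.δy_pos i
  have hv := h.δv_pos i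
  have hs := sechSq_pos (p.gp y i)
  have h2 : p.δy i ^ 2 - (p.f y i - p.yAvg i) ^ 2 = p.δy i ^ 2 * sechSq (p.gp y i) := by
    rw [sechSq, h.tanh_gp]
    field_simp
  rw [h2, abs_of_pos (show 0 < p.δy i ^ 2 * sechSq (p.gp y i) by positivity), mul_assoc] at h1
  have h3 := lt_of_mul_lt_mul_left h1 (by positivity)
  rw [ratio, abs_div, abs_of_pos (mul_pos hv hs), div_lt_one (mul_pos hv hs)]
  linarith

lemma contDiff_f (i : Fin n) : ContDiff ℝ 3 fun φ => p.f φ i := contDiff_pi.1 h.contDiff i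

lemma contDiff_deriv : ContDiff ℝ 2 (deriv p.f) :=
  ((contDiff_succ_iff_deriv (n := 2)).1 (by
    simpa [show (2 : WithTop ℕ∞) + 1 = 3 by norm_num] using h.contDiff)).2.2

lemma hasDerivAt_f (φ : ℝ) (i : Fin n) : HasDerivAt (fun φ => p.f φ i) (deriv p.f φ i) φ :=
  hasDerivAt_pi.1 (h.contDiff.differentiable three_ne_zero φ).hasDerivAt i

lemma hasDerivAt_gp (i : Fin n) (φ : ℝ) :
    HasDerivAt (fun φ => p.gp φ i) (p.δv i / p.δy i * ratio p i φ) φ := by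
  have h1 := (hasDerivAt_artanh (h.abs_f_div_lt φ i)).comp φ
    (((h.hasDerivAt_f φ i).sub_const (p.yAvg i)).div_const (p.δy i))
  have h2 : (fun φ => p.gp φ i) = Real.artanh ∘ fun φ => (p.f φ i - p.yAvg i) / p.δy i :=
    funext fun φ => h.gp_eq φ i
  rw [h2]
  refine h1.congr_deriv ?_
  have hs := (sechSq_pos (p.gp φ i)).ne'
  have hδ := (h.δy_pos i).ne'
  have hv := (h.δv_pos i).ne'
  rw [← h.tanh_gp]
  change 1 / sechSq (p.gp φ i) * _ = _
  rw [ratio]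
  field_simp

lemma contDiff_sechSq_gp (i : Fin n) : ContDiff ℝ 2 fun φ => sechSq (p.gp φ i) := by
  have : (fun φ => sechSq (p.gp φ i)) = fun φ => 1 - ((p.f φ i - p.yAvg i) / p.δy i) ^ 2 :=
    funext fun φ => by rw [sechSq, h.tanh_gp]
  rw [this]
  exact contDiff_const.sub (((((h.contDiff_f i).of_le (by norm_num)).sub
    contDiff_const).div_const _).pow 2)

lemma contDiff_ratio (i : Fin n) : ContDiff ℝ 2 (ratio p i) :=
  (contDiff_pi.1 h.contDiff_deriv i).div (contDiff_const.mul (h.contDiff_sechSq_gp i))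
    fun _ => (mul_pos (h.δv_pos i) (sechSq_pos _)).ne'

lemma B_eq : p.B = Matrix.diagonal fun i => p.B i i := h.B_diag.diagonal_diag.symm

lemma K_eq : p.K = Matrix.diagonal fun i => p.K i i := h.K_diag.diagonal_diag.symm

lemma D_eq : p.D = Matrix.diagonal fun i => p.D i i := h.D_diag.diagonal_diag.symm

lemma B_inv_eq : p.B⁻¹ = Matrix.diagonal fun i => (p.B i i)⁻¹ := by
  conv_lhs => rw [h.B_eq]
  exact inv_diagonal_of_ne_zero fun i => h.B_posDef.diag_pos.ne'

/-- A diagonal entry of the positive definite matrix `K B⁻¹ D - B` is `k d / b - b`. -/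
lemma B_sq_lt (i : Fin n) : p.B i i ^ 2 < p.K i i * p.D i i := by
  have h1 : 0 < (p.K * p.B⁻¹ * p.D - p.B) i i := h.KBD_posDef.diag_pos
  have hb : 0 < p.B i i := h.B_posDef.diag_pos
  have h2 : (p.K * p.B⁻¹ * p.D) i i = p.K i i * (p.B i i)⁻¹ * p.D i i := by
    conv_lhs => rw [h.B_inv_eq, h.K_eq, h.D_eq]
    simp
  rw [Matrix.sub_apply, h2, sub_pos, ← div_eq_mul_inv, div_mul_eq_mul_div, lt_div_iff₀ hb] at h1
  linarith

/-- The scalar model of admissible data. -/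
def model : Model n where
  κ i := p.δv i / p.δy i
  b i := p.B i i
  k i := p.K i i
  d i := p.D i i
  g i φ := p.gp φ i
  r := ratio p
  T := T
  T_pos := h.T_pos
  κ_pos i := div_pos (h.δv_pos i) (h.δy_pos i)
  b_pos _ := h.B_posDef.diag_pos
  k_pos _ := h.K_posDef.diag_pos
  d_pos _ := h.D_posDef.diag_pos
  b_sq_lt := h.B_sq_lt
  g_periodic i φ := by simp only [h.gp_periodic φ]
  r_periodic := h.ratio_periodic
  abs_r_lt_one := h.abs_ratio_lt_one
  contDiff_r := h.contDiff_ratio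
  hasDerivAt_g := h.hasDerivAt_gp

lemma Js_inv_eq (a : Fin n → ℝ) :
    (p.Js a)⁻¹ = Matrix.diagonal fun i => (p.δy i * sechSq (a i))⁻¹ := by
  rw [Js, sechMatrix_eq]
  exact inv_diagonal_of_ne_zero fun i => (mul_pos (h.δy_pos i) (sechSq_pos _)).ne'

lemma Jgp_inv_eq (φ : ℝ) :
    (p.Jgp φ)⁻¹ = Matrix.diagonal fun i => (p.δy i * sechSq (p.gp φ i))⁻¹ := h.Js_inv_eq _

lemma psi_eq (a : Fin n → ℝ) (φ : ℝ) (i : Fin n) :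
    p.psi a φ i = scalarPsi (a i) (ratio p i φ) := by
  rw [psi, h.Jgp_inv_eq, Js, sechMatrix_eq, Matrix.diagonal_mul_diagonal]
  simp only [vartanh, vtanh, Matrix.mulVec_diagonal, h.tanh_gv, scalarPsi, ratio]
  have hs := (sechSq_pos (p.gp φ i)).ne'
  have hδ := (h.δy_pos i).ne'
  have hv := (h.δv_pos i).ne'
  congr 1
  field_simp

/-- On the desired trajectory `sech² g_p · r = f' / δv`, so `ψ` equals `g_v` there. -/
lemma xStar_eq : p.xStar = h.model.limitShape := by
  funext φ
  rw [xStar, Model.limitShape]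
  congr 1
  funext i
  rw [h.gv_eq]
  change _ = Real.artanh (sechSq (p.gp φ i) * ratio p i φ)
  have hs := (sechSq_pos (p.gp φ i)).ne'
  have hv := (h.δv_pos i).ne'
  rw [ratio]
  congr 1
  field_simp

lemma s₁Dot_eq (a b : Fin n → ℝ) (i : Fin n) :
    p.s₁Dot a b i = p.δv i / p.δy i * Real.tanh (b i) / sechSq (a i) := by
  rw [s₁Dot, h.Js_inv_eq]
  simp only [Matrix.mulVec_diagonal, vtanh]
  have hs := (sechSq_pos (a i)).ne'
  have hδ := (h.δy_pos i).ne'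
  field_simp

lemma hasDerivAt_ratio (i : Fin n) (φ : ℝ) :
    HasDerivAt (ratio p i) (deriv (ratio p i) φ) φ :=
  ((h.contDiff_ratio i).differentiable two_ne_zero φ).hasDerivAt

lemma psiPhase_eq (a : Fin n → ℝ) (φ : ℝ) (i : Fin n) :
    p.psiPhase a φ i = scalarPsiR (a i) (ratio p i φ) * deriv (ratio p i) φ := by
  have hd : HasDerivAt (fun θ => p.psi a θ)
      (fun i => scalarPsiR (a i) (ratio p i φ) * deriv (ratio p i) φ) φ := by
    refine hasDerivAt_pi.2 fun i => ?_
    simp only [h.psi_eq]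
    rw [← hasDerivWithinAt_univ]
    exact (hasDerivWithinAt_scalarPsi (hasDerivWithinAt_const φ univ (a i))
      (h.hasDerivAt_ratio i φ).hasDerivWithinAt (h.abs_ratio_lt_one i φ)).congr_deriv (by simp)
  rw [psiPhase, hd.deriv]

lemma psiTime_eq (a b : Fin n → ℝ) (φ : ℝ) (i : Fin n) :
    p.psiTime a b φ i = scalarPsiS (a i) (ratio p i φ) * p.s₁Dot a b i := by
  have hd : HasFDerivAt (fun c => p.psi c φ) (ContinuousLinearMap.pi fun i =>
      scalarPsiS (a i) (ratio p i φ) • ContinuousLinearMap.proj (R := ℝ) (φ := fun _ => ℝ) i) a := by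
    refine hasFDerivAt_pi.2 fun i => ?_
    simp only [h.psi_eq]
    rw [← hasFDerivWithinAt_univ]
    refine (hasFDerivAt_scalarPsi (hasFDerivWithinAt_apply (𝕜 := ℝ) i a univ)
      (hasFDerivWithinAt_const (ratio p i φ) a univ) (h.abs_ratio_lt_one i φ)).congr_fderiv ?_
    simp
  rw [psiTime, hd.fderiv]
  simp

lemma field_eq (γ : ℝ) : p.field γ = h.model.field γ := by
  funext z
  have hpsi : ∀ i, p.psi (s₁ z) (phase z) i = h.model.psi z i := h.psi_eq _ _
  have he1 : ∀ i, p.e₁ (s₁ z) (phase z) i = h.model.err₁ z i := fun i => rfl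
  have he2 : ∀ i, p.e₂ (s₁ z) (s₂ z) (phase z) i = h.model.err₂ z i := fun i => by
    rw [e₂, Pi.sub_apply, hpsi, Model.err₂]
  have hph : ∀ i, p.psiPhase (s₁ z) (phase z) i = h.model.psiPhase z i := h.psiPhase_eq _ _
  have hv1 : ∀ i, p.s₁Dot (s₁ z) (s₂ z) i = h.model.vel₁ z i := h.s₁Dot_eq _ _
  have hv2 : ∀ i, p.s₂Dot (s₁ z) (s₂ z) (phase z) i = h.model.vel₂ z i := fun i => by
    have hs := (sechSq_pos (s₁ z i)).ne'
    have hδ := (h.δy_pos i).ne'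
    rw [s₂Dot, h.B_inv_eq, h.Js_inv_eq, h.B_eq, h.K_eq, h.D_eq]
    simp only [Matrix.diagonal_mul_diagonal, Matrix.mulVec_diagonal, Pi.sub_apply, Pi.add_apply,
      Matrix.diagonal_apply_eq, vtanh, hpsi, he1, he2, hph, h.psiTime_eq, hv1]
    change _ = h.model.psiPhase z i + scalarPsiS (s₁ z i) (ratio p i (phase z)) * h.model.vel₁ z i
      - p.B i i * h.model.err₁ z i - p.K i i * h.model.err₂ z i - p.D i i / p.B i i *
      (p.δv i / p.δy i * (Real.tanh (s₂ z i) - Real.tanh (h.model.psi z i)) / sechSq (s₁ z i))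
    have hb : p.B i i ≠ 0 := h.B_posDef.diag_pos.ne'
    field_simp
  have hφ : p.phaseDot γ (s₁ z) (s₂ z) (phase z) = 1 + γ * h.model.slope z := by
    rw [phaseDot, h.Jgp_inv_eq, h.B_eq, h.K_eq, h.D_eq]
    simp only [dotProduct, Matrix.diagonal_mul_diagonal, Matrix.mulVec_diagonal,
      Matrix.vecMul_diagonal, Pi.add_apply, vtanh, h.tanh_gv, he1, he2, hph]
    rw [← Finset.sum_add_distrib, Model.slope]
    congr 2
    refine Finset.sum_congr rfl fun i _ => ?_
    change _ = (p.D i i * h.model.err₁ z i + p.B i i * h.model.err₂ z i) *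
      (p.δv i / p.δy i * ratio p i (phase z)) +
      (p.B i i * h.model.err₁ z i + p.K i i * h.model.err₂ z i) * h.model.psiPhase z i
    have hs := (sechSq_pos (p.gp (phase z) i)).ne'
    have hδ := (h.δy_pos i).ne'
    have hv := (h.δv_pos i).ne'
    rw [ratio]
    field_simp
  rw [field, Model.field, hφ]
  congr 2
  · exact funext hv1
  · exact funext hv2

/-- By definition `f'` is `r` times a positive differentiable function, so a common zero of all `r`
and `r'` is, by the product rule, a common zero of `f'` and `f''`. -/
lemma nondegenerate (hnd : ∀ φ : ℝ, deriv p.f φ ≠ 0 ∨ deriv (deriv p.f) φ ≠ 0) (τ : ℝ) :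
    ∃ i, h.model.r i τ ≠ 0 ∨ deriv (h.model.r i) τ ≠ 0 := by
  by_contra! hcon
  have hr : ∀ i, ratio p i τ = 0 := fun i => (hcon i).1
  have hr' : ∀ i, deriv (ratio p i) τ = 0 := fun i => (hcon i).2
  have hf : ∀ i φ, deriv p.f φ i = ratio p i φ * (p.δv i * sechSq (p.gp φ i)) := fun i φ => by
    rw [ratio, div_mul_cancel₀]
    exact (mul_pos (h.δv_pos i) (sechSq_pos _)).ne'
  rcases hnd τ with h1 | h1
  · exact h1 (funext fun i => by rw [hf, hr, zero_mul]; rfl)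
  · refine h1 (funext fun i => ?_)
    have hd := hasDerivAt_pi.1 (h.contDiff_deriv.differentiable two_ne_zero τ).hasDerivAt i
    have hs := (((h.contDiff_sechSq_gp i).differentiable two_ne_zero τ).hasDerivAt).const_mul
      (p.δv i)
    have hm := (h.hasDerivAt_ratio i τ).mul hs
    have he : (fun φ => deriv p.f φ i) = ratio p i * fun φ => p.δv i * sechSq (p.gp φ i) :=
      funext fun φ => hf i φ
    rw [he] at hd
    rw [hd.unique hm, hr, hr', zero_mul, zero_mul, add_zero]
    rfl

lemma limitShape_const {c : Fin n → ℝ} (hc : ∀ φ, p.f φ = c) (τ τ' : ℝ) :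
    h.model.limitShape τ = h.model.limitShape τ' := by
  have hf : p.f = fun _ => c := funext hc
  rw [← h.xStar_eq]
  simp [xStar, gp, gv, hf]

/-! #### The output -/

omit h in
/-- The output and its velocity as functions of the shape. -/
def outputMap (p : Data n) (x : ShapeSpace n) : ShapeSpace n :=
  mkShape (fun i => p.yAvg i + p.δy i * Real.tanh (x (Sum.inl i)))
    fun i => p.δv i * Real.tanh (x (Sum.inr i))

lemma qd_eq (φ : ℝ) : p.qd φ = outputMap p (p.xStar φ) := by
  rw [qd, outputMap]
  congr 1
  · funext i
    have := (h.δy_pos i).ne'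
    rw [xStar, mkShape_inl, h.tanh_gp]
    field_simp
    ring
  · funext i
    have := (h.δv_pos i).ne'
    rw [xStar, mkShape_inr, h.tanh_gv]
    field_simp

omit h in
lemma exists_outputMap_lipschitz (p : Data n) :
    ∃ C > 0, ∀ x x', ‖outputMap p x - outputMap p x'‖ ≤ C * ‖x - x'‖ := by
  obtain ⟨C, hC, hle⟩ := exists_pos_forall_ge fun j : Fin n ⊕ Fin n =>
    |Sum.elim p.δy p.δv j|
  refine ⟨C, hC, fun x x' => ?_⟩
  refine abs_le_of_sq_le_sq' ?_ (by positivity) |>.2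
  rw [mul_pow, EuclideanSpace.norm_sq_eq, EuclideanSpace.norm_sq_eq, Finset.mul_sum]
  refine Finset.sum_le_sum fun j _ => ?_
  rw [← mul_pow]
  refine pow_le_pow_left₀ (norm_nonneg _) ?_ 2
  have hj : (outputMap p x - outputMap p x') j =
      Sum.elim p.δy p.δv j * (Real.tanh (x j) - Real.tanh (x' j)) := by
    rcases j with i | i
    · simp [outputMap]; ring
    · simp [outputMap]; ring
  rw [hj, norm_mul]
  exact mul_le_mul (hle j) (abs_tanh_sub_tanh_le _ _) (norm_nonneg _) hC.le

lemma outputMap_mem (x : ShapeSpace n) : outputMap p x ∈ p.Q := by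
  intro i
  have h1 := Real.tanh_lt_one (x (Sum.inl i))
  have h2 := Real.neg_one_lt_tanh (x (Sum.inl i))
  have hδ := h.δy_pos i
  have e1 : p.yMin i = p.yAvg i - p.δy i := by rw [yAvg, δy]; ring
  have e2 : p.yMax i = p.yAvg i + p.δy i := by rw [yAvg, δy]; ring
  simp only [outputMap, mkShape_inl, mkShape_inr]
  refine ⟨by rw [e1]; nlinarith, by rw [e2]; nlinarith, ?_⟩
  rw [abs_mul, abs_of_pos (h.δv_pos i)]
  exact mul_lt_of_lt_one_right (h.δv_pos i) (Real.abs_tanh_lt_one _)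

/-- The factor `δy sech² s₁` of the chain rule cancels `J_{s₁}⁻¹`, so the output velocity is a
function of `s₂` alone and saturates below `δv`. -/
lemma hasDerivWithinAt_output {γ : ℝ} {z : ℝ → StateSpace n} (hz : IsSolution (p.field γ) z)
    {t : ℝ} (ht : 0 ≤ t) :
    HasDerivWithinAt (p.output z) (fun i => p.δv i * Real.tanh (s₂ (z t) i)) (Ici 0) t := by
  refine hasDerivWithinAt_pi.2 fun i => ?_
  have he : (fun t => p.output z t i) = fun t => p.yAvg i + p.δy i * Real.tanh (s₁ (z t) i) :=
    funext fun t => by simp [output, Matrix.mulVec_diagonal, vtanh]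
  rw [he]
  have h1 : HasDerivWithinAt (fun t => s₁ (z t) i) (p.s₁Dot (s₁ (z t)) (s₂ (z t)) i) (Ici 0) t :=
    (Model.hasDerivWithinAt_iff.1 (hz t ht)).1 i
  refine ((((hasDerivAt_tanh _).comp_hasDerivWithinAt t h1).const_mul (p.δy i)).const_add
    (p.yAvg i)).congr_deriv ?_
  have hs := (sechSq_pos (s₁ (z t) i)).ne'
  have hδ := (h.δy_pos i).ne'
  rw [h.s₁Dot_eq]
  field_simp

lemma outputPair_eq {γ : ℝ} {z : ℝ → StateSpace n} (hz : IsSolution (p.field γ) z)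
    {t : ℝ} (ht : 0 ≤ t) : p.outputPair z t = outputMap p (shape (z t)) := by
  rw [outputPair, (h.hasDerivWithinAt_output hz ht).derivWithin (uniqueDiffOn_Ici 0 t ht),
    outputMap]
  congr 1
  funext i
  simp [output, Matrix.mulVec_diagonal, vtanh, shape]

lemma tendsto_infDist_outputPair {γ : ℝ} (hγ : 0 ≤ γ) {z : ℝ → StateSpace n}
    (hz : IsSolution (p.field γ) z) :
    Tendsto (fun t => Metric.infDist (p.outputPair z t) (range p.qd)) atTop (𝓝 0) := by
  obtain ⟨C, hC, hlip⟩ := exists_outputMap_lipschitz p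
  have hz' : IsSolution (h.model.field γ) z := h.field_eq γ ▸ hz
  have hlim : Tendsto (fun t => C * ‖h.model.shapeErr (z t)‖) atTop (𝓝 0) := by
    simpa using (Model.tendsto_shapeErr hγ hz').norm.const_mul C
  refine tendsto_of_tendsto_of_tendsto_of_le_of_le' tendsto_const_nhds hlim
    (Eventually.of_forall fun t => Metric.infDist_nonneg) ?_
  filter_upwards [eventually_ge_atTop 0] with t ht
  refine (Metric.infDist_le_dist_of_mem (mem_range_self (phase (z t)))).trans ?_
  rw [dist_eq_norm, h.qd_eq, h.outputPair_eq hz ht, Model.shapeErr, ← h.xStar_eq]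
  exact hlip _ _

end Admissible

end Data

end BoundedOscillator

end

/-! ### Transfer of the results on the scalar model to the oscillator -/

theorem theorem3 {n : ℕ} (p : Data n) (T : ℝ) (hT : 0 < T)
    (hper : Function.Periodic p.f T) (hf : ContDiff ℝ 3 p.f)
    -- the desired trajectory respects the limits
    (hQ : ∀ t : ℝ, p.qd t ∈ p.Q)
    -- the condition that makes `ψ` well defined at every state
    (hψ : ∀ φ ∈ Icc (0 : ℝ) T, ∀ i : Fin n,
      p.δy i ^ 2 * |deriv p.f φ i| < |p.δy i ^ 2 - (p.f φ i - p.yAvg i) ^ 2| * p.δv i)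
    (hBdiag : p.B.IsDiag) (hKdiag : p.K.IsDiag) (hDdiag : p.D.IsDiag)
    (hB : p.B.PosDef) (hK : p.K.PosDef) (hD : p.D.PosDef)
    (hKBD : (p.K * p.B⁻¹ * p.D - p.B).PosDef) :
    -- well-posedness: a unique solution for all `t ≥ 0` from every initial state
    (∀ γ : ℝ, 0 ≤ γ → ∀ z₀ : StateSpace n, ∃ z : ℝ → StateSpace n,
      z 0 = z₀ ∧ IsSolution (p.field γ) z ∧
      ∀ w : ℝ → StateSpace n, w 0 = z₀ → IsSolution (p.field γ) w → EqOn w z (Ici 0)) ∧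
    -- 1) boundedness, and convergence to `x*(φ)`
    (∀ γ : ℝ, 0 ≤ γ → ∀ z : ℝ → StateSpace n, IsSolution (p.field γ) z →
      Bornology.IsBounded ((fun t => shape (z t)) '' Ici 0) ∧
      Tendsto (fun t => shape (z t) - p.xStar (phase (z t))) atTop (𝓝 0)) ∧
    -- 2) `γ = 0`: `[x*(t + φ(0)); t + φ(0)]` is globally asymptotically stable
    (∀ φ₀ : ℝ,
      IsSolution (p.field 0) (fun t => mkState (p.xStar (t + φ₀)) (t + φ₀)) ∧
      StableTrajectory (p.field 0) (fun t => mkState (p.xStar (t + φ₀)) (t + φ₀)) ∧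
      ∀ z : ℝ → StateSpace n, IsSolution (p.field 0) z → phase (z 0) = φ₀ →
        Tendsto (fun t => z t - mkState (p.xStar (t + φ₀)) (t + φ₀)) atTop (𝓝 0)) ∧
    -- 3) `x*` is a globally stable limit cycle: in the state space, for every gain,
    (∀ γ : ℝ, 0 ≤ γ →
      IsSolution (p.field γ) (fun t => mkState (p.xStar t) t) ∧
      OrbitallyStable (p.field γ) (range fun τ => mkState (p.xStar τ) τ) ∧
      GloballyAttracting (p.field γ) (range fun τ => mkState (p.xStar τ) τ)) ∧
    -- and in the shape space: global attraction to the closed curve `x*` for every gain,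
    (Function.Periodic p.xStar T ∧
      ∀ γ : ℝ, 0 ≤ γ → ∀ z : ℝ → StateSpace n, IsSolution (p.field γ) z →
        Tendsto (fun t => Metric.infDist (shape (z t)) (range p.xStar)) atTop (𝓝 0)) ∧
    -- orbital stability as `γ → ∞`, for initial phase errors up to a fixed size `ρ`
    (((∀ φ : ℝ, deriv p.f φ ≠ 0 ∨ deriv (deriv p.f) φ ≠ 0) ∨ ∃ c, ∀ φ : ℝ, p.f φ = c) →
      ∃ ρ > 0, ∀ ε > 0, ∃ δ > 0, ∀ᶠ γ : ℝ in atTop,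
        ∀ z : ℝ → StateSpace n, IsSolution (p.field γ) z → ∀ t₀ ≥ 0,
          (∃ τ : ℝ, |τ - phase (z t₀)| < ρ ∧ ‖shape (z t₀) - p.xStar τ‖ < δ) →
          ∀ t ≥ t₀, Metric.infDist (shape (z t)) (range p.xStar) < ε) ∧
    -- 4) the output respects the limits and converges to the curve of `q_d`
    (∀ γ : ℝ, 0 ≤ γ → ∀ z : ℝ → StateSpace n, IsSolution (p.field γ) z →
      DifferentiableOn ℝ (p.output z) (Ici 0) ∧
      (∀ t ≥ 0, p.outputPair z t ∈ p.Q) ∧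
      Tendsto (fun t => Metric.infDist (p.outputPair z t) (range p.qd)) atTop (𝓝 0)) := by
  have h : p.Admissible T :=
    ⟨hT, hper, hf, hQ, hψ, hBdiag, hKdiag, hDdiag, hB, hK, hD, hKBD⟩
  simp only [h.field_eq, h.xStar_eq]
  refine ⟨fun γ hγ z₀ => ?_, fun γ hγ z hz => ⟨Model.isBounded_shape hγ hz,
      Model.tendsto_shapeErr hγ hz⟩, fun φ₀ => ⟨h.model.isSolution_limitState_add 0 φ₀,
      h.model.stableTrajectory_limitState φ₀, fun z hz hφ => ?_⟩, fun γ hγ =>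
    ⟨h.model.isSolution_limitState γ, h.model.orbitallyStable_limitState hγ,
      h.model.globallyAttracting_limitState hγ⟩, ⟨h.model.limitShape_periodic,
      fun γ hγ z hz => h.model.tendsto_infDist_shape hγ hz⟩, fun hnd => ?_, fun γ hγ z hz => ?_⟩
  · obtain ⟨z, hz0, hz⟩ := h.model.exists_isSolution hγ z₀
    exact ⟨z, hz0, hz, fun w hw0 hw =>
      hw.eqOn (h.model.contDiff_field γ) hz (hw0.trans hz0.symm)⟩
  · rw [← hφ]
    exact h.model.tendsto_sub_limitState hz
  · rcases hnd with hnd | ⟨c, hc⟩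
    · exact h.model.highGain_stable (h.nondegenerate hnd)
    · exact h.model.highGain_stable_of_const (h.limitShape_const hc)
  · rw [← h.field_eq] at hz
    refine ⟨fun t ht => (h.hasDerivWithinAt_output hz ht).differentiableWithinAt, fun t ht => ?_,
      h.tendsto_infDist_outputPair hγ hz⟩
    rw [h.outputPair_eq hz ht]
    exact h.outputMap_mem _
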